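/- Let $\mathfrak K$ be a field, $\mathfrak R=\mathfrak K[x_1,\dots,x_n]$, $F=(f_1,\dots,f_m)$ a finite sequence in $\mathfrak R$, and let $a\mapsto\overline a$ be the $\mathfrak R$-linear map $\mathfrak R^m\to\mathfrak R$ with $\overline{\mathbf e_i}=f_i$. Let $\preceq$ be an admissible (linear) order on power-products, with leading power-product $\mathrm{lp}$ and leading coefficient $\mathrm{lc}$, and let $\preceq_{\mathsf t}$ be a compatible term order on the terms $t\,\mathbf e_i$ of $\mathfrak R^m$. The signature $\mathfrak s(a)$ of $a\ne0$ is its $\preceq_{\mathsf t}$-leading term (without coefficient); for terms, $u\mid v$ means $v=t\,u$ for some power-product $t$. *Reduction.* An element $a$ $\mathfrak s$-reduces in one step modulo $G\subseteq\mathfrak R^m$ to $b$ if there are $g\in G$ and a power-product $t$ with $\overline g\neq0$, $t\,\mathrm{lp}(\overline g)\in\mathrm{supp}(\overline a)$, $t\,\mathfrak s(g)\preceq_{\mathsf t}\mathfrak s(a)$ and $b=a-\frac{\mathrm{coeff}(\overline a,\,t\,\mathrm{lp}(\overline g))}{\mathrm{lc}(\overline g)}\,t\,g$. The step is regular if $t\,\mathfrak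 s(g)\prec_{\mathsf t}\mathfrak s(a)$, and top if $t\,\mathrm{lp}(\overline g)=\mathrm{lp}(\overline a)$. A result of regular $\mathfrak s$-reducing $a$ is an element that is reached from $a$ by finitely many regular steps and admits no further regular step. $G$ is a signature Gröbner basis up to $u$ if every $a\neq 0$ with $\mathfrak s(a)\prec_{\mathsf t}u$ $\mathfrak s$-reduces in finitely many steps to some $b$ with $\overline b=0$. *Rewriting.* A rewrite order is a reflexive, transitive, total relation $\trianglelefteq$ on the pairs $(\mathfrak s(a),\overline a)$, $a\in\mathfrak R^m\setminus\{0\}$, such that (i) $(u,p)\trianglelefteq(v,q)\trianglelefteq(u,p)$ implies $u=v$, and (ii) $(\mathfrak s(a),\overline a)\trianglelefteq(\mathfrak s(b),\overline b)$ whenever $a,b\in G\setminus\{0\}$, $\mathfrak s(a)\mid\mathfrak s(b)$, $G$ is a signature Gröbner basis up to $\mathfrak s(b)$ and $b$ admits no regular top $\mathfrak s$-reduction step modulo $G$. Fix a rewrite order. An element $a$ is a canonical rewriter in $w$ w.r.t. $G$ if it is $\trianglelefteq$-maximal among the $g\in G\setminus\{0\}$ with $\mathfrak s(g)\mid w$ (elements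 being compared through their pairs). For $a,b$ with $\overline a,\overline b\neq0$ and $t=\mathrm{lcm}(\mathrm{lp}(\overline a),\mathrm{lp}(\overline b))$ put $u_a=\frac{t}{\mathrm{lp}(\overline a)}\mathfrak s(a)$, $u_b=\frac{t}{\mathrm{lp}(\overline b)}\mathfrak s(b)$ and $\mathrm{spair}(a,b)=\frac{t}{\mathrm{lc}(\overline a)\mathrm{lp}(\overline a)}a-\frac{t}{\mathrm{lc}(\overline b)\mathrm{lp}(\overline b)}b$; this S-pair is regular if $u_a\neq u_b$. *Algorithm RB.* Start with $G=\emptyset$, $S$ the set of signatures of the nonzero elements $f_j\mathbf e_i-f_i\mathbf e_j$ ($i<j$), $P=\{\mathbf e_1,\dots,\mathbf e_m\}$ and the counter $z=0$. While $P\ne\emptyset$: remove from $P$ some element $a$ with $\preceq_{\mathsf t}$-minimal signature. If $a$ is a basis vector $\mathbf e_i$, add to $S$ the signatures of the nonzero elements $f_i\,g-\overline g\,\mathbf e_i$, $g\in G$. Discard $a$ if $a=\mathbf e_i$ and some $s\in S$ divides $\mathbf e_i$, or if $a=\mathrm{spair}(c,d)$ and some $s\in S$ divides $u_c$ or $u_d$,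 or $c$ is not a canonical rewriter in $u_c$ w.r.t. $G$, or $d$ is not one in $u_d$. Otherwise let $b$ be a result of regular $\mathfrak s$-reducing $a$ modulo $G$, and test whether $\overline b=0$. If so (a zero-reduction), add $\mathfrak s(b)$ to $S$ and increase $z$ by $1$; if not, add to $P$ all regular S-pairs $\mathrm{spair}(g,b)$, $g\in G$, and then add $b$ to $G$. When $P=\emptyset$, return $G$ and $z$. **Theorem.** Let $(f_1,\dots,f_m)$ be a regular sequence, in the sense that for every $j$ and every $q\in\mathfrak R$, $q f_j\in\langle f_1,\dots,f_{j-1}\rangle$ implies $q\in\langle f_1,\dots,f_{j-1}\rangle$. Let $\trianglelefteq$ be any rewrite order, and let $\preceq_{\mathsf t}$ be the position-over-term extension of $\preceq$: $s\,\mathbf e_i\preceq_{\mathsf t}t\,\mathbf e_j$ if and only if $i<j$, or $i=j$ and $s\preceq t$. Then, however the choices in Algorithm RB are made, it never $\mathfrak s$-reduces an element to zero: the test $\overline b=0$ always yields `False'. Moreover the algorithm terminates, and the zero-reduction counter $z$ that it returns is $0$. -/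

import Mathlib

open scoped MonomialOrder

noncomputable section

namespace SigRB

/-- Power-products in `n` indeterminates, written additively (as exponent vectors). -/
abbrev PP (n : ℕ) : Type := Fin n →₀ ℕ

/-- Terms `t 𝐞ᵢ` of the free module of rank `m`: pairs of a power-product and a component. -/
abbrev Term (n m : ℕ) : Type := PP n × Fin m

/-- The free module `𝔎[x₁, …, xₙ]ᵐ`. -/
abbrev FreeMod (n m : ℕ) (K : Type*) [CommSemiring K] : Type _ := Fin m → MvPolynomial (Fin n) K

variable {n m : ℕ}

/-- The product of a power-product and a term. -/
def Term.mul (t : PP n) (u : Term n m) : Term n m := (t + u.1, u.2)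

/-- Divisibility of terms. -/
def Term.Dvd (u v : Term n m) : Prop := ∃ t : PP n, v = Term.mul t u

/-- A term order on the terms `t 𝐞ᵢ` which is a compatible extension of the admissible order `mo`. -/
structure ModuleTermOrder (mo : MonomialOrder (Fin n)) (m : ℕ) where
  le : Term n m → Term n m → Prop
  refl : ∀ u, le u u
  trans : ∀ u v w, le u v → le v w → le u w
  antisymm : ∀ u v, le u v → le v u → u = v
  total : ∀ u v, le u v ∨ le v u
  mul_mono : ∀ (t : PP n) (u v : Term n m), le u v → le (Term.mul t u) (Term.mul t v)
  compatible : ∀ (s t : PP n) (i : Fin m), s ≼[mo] t → le (s, i) (t, i)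

namespace ModuleTermOrder

variable {mo : MonomialOrder (Fin n)}

/-- The strict part of a term order. -/
def lt (τ : ModuleTermOrder mo m) (u v : Term n m) : Prop := τ.le u v ∧ u ≠ v

/-- `τ` is the position-over-term extension of `mo`. -/
def IsPot (τ : ModuleTermOrder mo m) : Prop :=
  ∀ (s t : PP n) (i j : Fin m), τ.le (s, i) (t, j) ↔ i < j ∨ (i = j ∧ s ≼[mo] t)

end ModuleTermOrder

variable {K : Type*} [Field K]

/-- The module homomorphism `a ↦ a̅` that sends `𝐞ᵢ` to `fᵢ`. -/
def bar (F : Fin m → MvPolynomial (Fin n) K) (a : FreeMod n m K) : MvPolynomial (Fin n) K :=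
  ∑ i, a i * F i

/-- The `i`-th canonical basis vector. -/
def basisVec (n : ℕ) {m : ℕ} (K : Type*) [Field K] (i : Fin m) : FreeMod n m K :=
  Pi.single i 1

/-- The terms that appear in a module element with non-zero coefficient. -/
def termSupp (a : FreeMod n m K) : Set (Term n m) := {u | u.1 ∈ (a u.2).support}

/-- `(f₁, …, fₘ)` is a regular sequence: each `fⱼ` is a non-zero-divisor modulo the ideal generated
by the preceding polynomials. -/
def IsRegularSequence (F : Fin m → MvPolynomial (Fin n) K) : Prop :=
  ∀ (j : Fin m) (q : MvPolynomial (Fin n) K),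
    q * F j ∈ Ideal.span (F '' {i | i < j}) → q ∈ Ideal.span (F '' {i | i < j})

variable {mo : MonomialOrder (Fin n)} (τ : ModuleTermOrder mo m)

/-- `u` is the signature (the leading term) of `a`. The zero element has no signature. -/
def IsSig (a : FreeMod n m K) (u : Term n m) : Prop :=
  u ∈ termSupp a ∧ ∀ v ∈ termSupp a, τ.le v u

variable (F : Fin m → MvPolynomial (Fin n) K)

/-- One step `a ⟶ b` of `𝔰`-reduction modulo `G`. The relation `r₁` compares the signature of the
multiple of the reducer with that of `a`; the relation `r₂` compares its leading power-product with
that of `a̅`. -/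
def SRed (r₁ : Term n m → Term n m → Prop) (r₂ : PP n → PP n → Prop) (G : Set (FreeMod n m K))
    (a b : FreeMod n m K) : Prop :=
  ∃ g ∈ G, ∃ t : PP n, bar F g ≠ 0 ∧
    t + mo.degree (bar F g) ∈ (bar F a).support ∧
    b = a - MvPolynomial.monomial t
      ((bar F a).coeff (t + mo.degree (bar F g)) / mo.leadingCoeff (bar F g)) • g ∧
    (∃ u v, IsSig τ g u ∧ IsSig τ a v ∧ r₁ (Term.mul t u) v) ∧
    r₂ (t + mo.degree (bar F g)) (mo.degree (bar F a))

/-- General `𝔰`-reduction. -/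
def GenRed : Set (FreeMod n m K) → FreeMod n m K → FreeMod n m K → Prop :=
  SRed τ F τ.le (fun s t => s ≼[mo] t)

/-- Regular `𝔰`-reduction. -/
def RegRed : Set (FreeMod n m K) → FreeMod n m K → FreeMod n m K → Prop :=
  SRed τ F τ.lt (fun s t => s ≼[mo] t)

/-- Regular top `𝔰`-reduction. -/
def RegTopRed : Set (FreeMod n m K) → FreeMod n m K → FreeMod n m K → Prop :=
  SRed τ F τ.lt (fun s t => s = t)

/-- `b` is a result of regular `𝔰`-reducing `a` modulo `G` (as far as possible). -/
def IsRegNormalForm (G : Set (FreeMod n m K)) (a b : FreeMod n m K) : Prop :=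
  Relation.ReflTransGen (RegRed τ F G) a b ∧ ∀ c, ¬ RegRed τ F G b c

/-- `a` `𝔰`-reduces to zero modulo `G`, i.e. to a syzygy. -/
def SRedZero (G : Set (FreeMod n m K)) (a : FreeMod n m K) : Prop :=
  ∃ b, Relation.ReflTransGen (GenRed τ F G) a b ∧ bar F b = 0

/-- `G` is a signature Gröbner basis in the term `u`. -/
def IsSigGBIn (G : Set (FreeMod n m K)) (u : Term n m) : Prop :=
  ∀ a, IsSig τ a u → SRedZero τ F G a

/-- `G` is a signature Gröbner basis up to the term `u`. -/
def IsSigGBUpTo (G : Set (FreeMod n m K)) (u : Term n m) : Prop :=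
  ∀ v, τ.lt v u → IsSigGBIn τ F G v

/-- Sig-poly-pairs `(𝔰(a), a̅)`, for `a ≠ 0`. -/
def IsSigPolyPair (x : Term n m × MvPolynomial (Fin n) K) : Prop :=
  ∃ a : FreeMod n m K, IsSig τ a x.1 ∧ bar F a = x.2

/-- Rewrite orders. Only the values of `rwo` on sig-poly-pairs matter. -/
structure IsRewriteOrder
    (rwo : Term n m × MvPolynomial (Fin n) K → Term n m × MvPolynomial (Fin n) K → Prop) :
    Prop where
  refl : ∀ x, IsSigPolyPair τ F x → rwo x x
  trans : ∀ x y z, IsSigPolyPair τ F x → IsSigPolyPair τ F y → IsSigPolyPair τ F z →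
    rwo x y → rwo y z → rwo x z
  total : ∀ x y, IsSigPolyPair τ F x → IsSigPolyPair τ F y → rwo x y ∨ rwo y x
  sig_eq : ∀ x y, IsSigPolyPair τ F x → IsSigPolyPair τ F y → rwo x y → rwo y x → x.1 = y.1
  of_dvd : ∀ (G : Set (FreeMod n m K)) (a b : FreeMod n m K) (u v : Term n m),
    a ∈ G → b ∈ G → IsSig τ a u → IsSig τ b v → IsSigGBUpTo τ F G v →
    (∀ c, ¬ RegTopRed τ F G b c) → Term.Dvd u v → rwo (u, bar F a) (v, bar F b)

variable (rwo : Term n m × MvPolynomial (Fin n) K → Term n m × MvPolynomial (Fin n) K → Prop)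

/-- `a` is a canonical rewriter in signature `w` with respect to `G`. -/
def IsCanonRewriter (G : Set (FreeMod n m K)) (w : Term n m) (a : FreeMod n m K) : Prop :=
  a ∈ G ∧ ∃ u, IsSig τ a u ∧ Term.Dvd u w ∧
    ∀ g ∈ G, ∀ v, IsSig τ g v → Term.Dvd v w → rwo (v, bar F g) (u, bar F a)

/-- The cofactor `lcm(lp(p), lp(q)) / lp(p)`. -/
def cofactor (mo : MonomialOrder (Fin n)) (p q : MvPolynomial (Fin n) K) : PP n :=
  (mo.degree p ⊔ mo.degree q) - mo.degree p

/-- The S-pair of `a` and `b`. -/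
def spair (mo : MonomialOrder (Fin n)) (F : Fin m → MvPolynomial (Fin n) K)
    (a b : FreeMod n m K) : FreeMod n m K :=
  MvPolynomial.monomial (cofactor mo (bar F a) (bar F b)) (mo.leadingCoeff (bar F a))⁻¹ • a -
    MvPolynomial.monomial (cofactor mo (bar F b) (bar F a)) (mo.leadingCoeff (bar F b))⁻¹ • b

/-- `w` is the signature of the multiple of `a` that occurs in the S-pair of `a` and `b`. -/
def IsSPairTerm (a b : FreeMod n m K) (w : Term n m) : Prop :=
  ∃ u, IsSig τ a u ∧ w = Term.mul (cofactor mo (bar F a) (bar F b)) u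

/-- `a` and `b` give rise to a regular S-pair. -/
def IsRegularSPair (a b : FreeMod n m K) : Prop :=
  bar F a ≠ 0 ∧ bar F b ≠ 0 ∧
    ∃ u v, IsSPairTerm τ F a b u ∧ IsSPairTerm τ F b a v ∧ u ≠ v

/-- Elements of the set `P` of the algorithm: canonical basis vectors, and S-pairs, represented by
the two module elements they originate from. -/
inductive Pair (n m : ℕ) (K : Type*) [Field K]
  | basis (i : Fin m)
  | spair (a b : FreeMod n m K)

/-- The module element represented by an element of `P`. -/
def Pair.toMod (mo : MonomialOrder (Fin n)) (F : Fin m → MvPolynomial (Fin n) K) :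
    Pair n m K → FreeMod n m K
  | .basis i => basisVec n K i
  | .spair a b => SigRB.spair mo F a b

/-- A state of the main loop of the algorithm: the basis `G` computed so far, the known syzygy
signatures `S`, the elements `P` still to be considered, and the number `z` of zero-reductions that
took place so far. -/
structure State (n m : ℕ) (K : Type*) [Field K] where
  G : Set (FreeMod n m K)
  S : Set (Term n m)
  P : Set (Pair n m K)
  z : ℕ

/-- The initial state; `S` consists of the signatures of the Koszul syzygies. -/
def initState : State n m K where
  G := ∅
  S := {u | ∃ i j, i < j ∧ IsSig τ (F j • basisVec n K i - F i • basisVec n K j) u}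
  P := Set.range Pair.basis
  z := 0

/-- The syzygy signatures that are added to `S` when `p` has been chosen from `P`. -/
def newSyzSigs (G : Set (FreeMod n m K)) : Pair n m K → Set (Term n m)
  | .basis i => {u | ∃ g ∈ G, IsSig τ (F i • g - bar F g • basisVec n K i) u}
  | .spair _ _ => ∅

/-- The criterion by which an element of `P` is discarded without being `𝔰`-reduced. -/
def SigCrit (G : Set (FreeMod n m K)) (S : Set (Term n m)) : Pair n m K → Prop
  | .basis i => ∃ s ∈ S, Term.Dvd s (0, i)
  | .spair a b =>
      (∃ w, IsSPairTerm τ F a b w ∧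
        ((∃ s ∈ S, Term.Dvd s w) ∨ ¬ IsCanonRewriter τ F rwo G w a)) ∨
      (∃ w, IsSPairTerm τ F b a w ∧
        ((∃ s ∈ S, Term.Dvd s w) ∨ ¬ IsCanonRewriter τ F rwo G w b))

/-- `p` may be chosen from `P`: it is an element of `P` with minimal signature. -/
def IsSelectable (P : Set (Pair n m K)) (p : Pair n m K) : Prop :=
  p ∈ P ∧ ∃ u, IsSig τ (p.toMod mo F) u ∧ ∀ q ∈ P, ∀ v, IsSig τ (q.toMod mo F) v → τ.le u v

/-- In state `st`, the algorithm may choose `p` from `P`, find that the criterion does not apply,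
regular `𝔰`-reduce `p` to `b`, and thus arrive at the test whether `b̅ = 0`. -/
def ReachesZeroTest (st : State n m K) (p : Pair n m K) (b : FreeMod n m K) : Prop :=
  IsSelectable τ F st.P p ∧ ¬ SigCrit τ F rwo st.G (st.S ∪ newSyzSigs τ F st.G p) p ∧
    IsRegNormalForm τ F st.G (p.toMod mo F) b

/-- One iteration of the main loop. -/
inductive Step : State n m K → State n m K → Prop
  | discard (st : State n m K) (p : Pair n m K) :
      IsSelectable τ F st.P p →
      SigCrit τ F rwo st.G (st.S ∪ newSyzSigs τ F st.G p) p →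
      Step st ⟨st.G, st.S ∪ newSyzSigs τ F st.G p, st.P \ {p}, st.z⟩
  | zeroReduction (st : State n m K) (p : Pair n m K) (b : FreeMod n m K) :
      ReachesZeroTest τ F rwo st p b → bar F b = 0 →
      Step st ⟨st.G, st.S ∪ newSyzSigs τ F st.G p ∪ {u | IsSig τ b u}, st.P \ {p}, st.z + 1⟩
  | addToBasis (st : State n m K) (p : Pair n m K) (b : FreeMod n m K) :
      ReachesZeroTest τ F rwo st p b → bar F b ≠ 0 →
      Step st ⟨insert b st.G, st.S ∪ newSyzSigs τ F st.G p,
        (st.P \ {p}) ∪ {q | ∃ g ∈ st.G, IsRegularSPair τ F g b ∧ q = Pair.spair g b}, st.z⟩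

/-- `st` occurs in some execution of the algorithm. -/
def Reachable (st : State n m K) : Prop :=
  Relation.ReflTransGen (Step τ F rwo) (initState τ F) st

/-- Some execution of the algorithm leaves the main loop and returns the basis `G` together with
the counter `z`. -/
def Returns (G : Set (FreeMod n m K)) (z : ℕ) : Prop :=
  ∃ st : State n m K, Reachable τ F rwo st ∧ st.P = ∅ ∧ st.G = G ∧ st.z = z

/-- Every execution of the algorithm terminates: there is no infinite execution, and an execution
never gets stuck inside the main loop. -/
def Terminates : Prop :=
  (¬ ∃ run : ℕ → State n m K, run 0 = initState τ F ∧ ∀ k, Step τ F rwo (run k) (run (k + 1))) ∧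
    ∀ st, Reachable τ F rwo st → st.P ≠ ∅ → ∃ st', Step τ F rwo st st'

end SigRB

end

/-!
The algorithm considers signatures in increasing order, so its correctness and the absence of
zero-reductions are proved together, as parts of one loop invariant (`Invariant`).

*Correctness.* Let `u` be smaller than all pending signatures. By well-founded induction on `u`,
either `u` is a syzygy signature, or the multiple `t r` with signature `u` of a canonical rewriter
`r` in `u` is not regular top reducible
(`Invariant.isRewriteBasisIn_and_isSigGBIn`). If it were, let `v` be the smallest signature of an
element with the leading power-product of `t r`. Then `v` is smaller than `u` and not a syzygy
signature, so the induction hypothesis yields a multiple of a canonical rewriter `d` in `v` with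
that leading power-product. The S-pair of `r` and `d` was neither discarded, as both are canonical
rewriters and `u`, `v` are not syzygy signatures, nor did it yield a basis element, because such an
element and `r` would precede each other in the rewrite order
(`Invariant.not_isSig_of_isCanonRewriter`). Since a regular top irreducible element has the least
leading power-product among the elements with its signature (`IsSigGBUpTo.degree_le`), every
element with signature `u` is then reduced to a smaller signature by `t r`
(`isSigGBIn_of_not_hasReducer`).

*No zero-reductions.* Let `u = t 𝐞ᵢ` be the signature of a syzygy `h`. By the position-over-term
order and regularity, the polynomial `hᵢ`, whose leading power-product is `t`, lies in the ideal
`⟨f₁, …, fᵢ₋₁⟩`. When `𝐞ᵢ` was selected, the basis contained a Gröbner basis of this ideal, so `t`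
is a multiple of `lp(g̅)` for one of its elements `g`, and `u` is divisible by the signature
`lp(g̅) 𝐞ᵢ` of the Koszul syzygy `fᵢ g - g̅ 𝐞ᵢ`, which was added to `S` at that time
(`Invariant.exists_newSyzSigs_dvd`). Hence elements with syzygy signatures are discarded.

*Termination.* If a basis element divides another one both in signature and in leading
power-product, then the ratios of signature and leading power-product of the two agree
(`Invariant.not_ratioLT`). By Dickson's lemma only finitely many ratios occur. An element that
stems from an S-pair has a larger ratio than both elements of the pair, and an element of the
basis is determined by its signature, so that only finitely many elements belong to each ratio
(`finite_of_ratioLT`).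
-/

namespace SigRB

variable {n m : ℕ} {K : Type*} [Field K] {mo : MonomialOrder (Fin n)}

/-! ### Terms and term orders -/

lemma Term.mul_add (s t : PP n) (u : Term n m) :
    Term.mul (s + t) u = Term.mul s (Term.mul t u) := by
  simp [Term.mul, add_assoc]

lemma Term.mul_comm (s t : PP n) (u : Term n m) :
    Term.mul s (Term.mul t u) = Term.mul t (Term.mul s u) := by
  simp [Term.mul, add_left_comm]

@[simp] lemma Term.zero_mul (u : Term n m) : Term.mul 0 u = u := by simp [Term.mul]

lemma Term.mul_injective (t : PP n) : Function.Injective (Term.mul (m := m) t) := by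
  rintro ⟨a, i⟩ ⟨b, j⟩ h
  simpa [Term.mul] using h

lemma Term.Dvd.refl (u : Term n m) : Term.Dvd u u := ⟨0, by simp⟩

lemma Term.Dvd.trans {u v w : Term n m} (h₁ : Term.Dvd u v) (h₂ : Term.Dvd v w) :
    Term.Dvd u w := by
  obtain ⟨s, rfl⟩ := h₁
  obtain ⟨t, rfl⟩ := h₂
  exact ⟨t + s, (Term.mul_add ..).symm⟩

/-- A total transitive relation on a finite nonempty set has a greatest element. -/
lemma exists_greatest_of_finite {α : Type*} {s : Set α} (hs : s.Finite) (hne : s.Nonempty)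
    (r : α → α → Prop)
    (htr : ∀ a ∈ s, ∀ b ∈ s, ∀ c ∈ s, r a b → r b c → r a c)
    (htot : ∀ a ∈ s, ∀ b ∈ s, r a b ∨ r b a) : ∃ a ∈ s, ∀ b ∈ s, r b a := by
  induction s, hs using Set.Finite.induction_on with
  | empty => exact absurd hne Set.not_nonempty_empty
  | @insert x s hx hs ih =>
    have hxx : r x x := (htot x (by simp) x (by simp)).elim id id
    rcases s.eq_empty_or_nonempty with rfl | hne'
    · exact ⟨x, by simp, by simpa using hxx⟩
    obtain ⟨a, ha, hmax⟩ := ih hne'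
      (fun a ha b hb c hc => htr a (.inr ha) b (.inr hb) c (.inr hc))
      (fun a ha b hb => htot a (.inr ha) b (.inr hb))
    rcases htot a (.inr ha) x (.inl rfl) with h | h
    · refine ⟨x, .inl rfl, ?_⟩
      rintro b (rfl | hb)
      · exact hxx
      · exact htr b (.inr hb) a (.inr ha) x (.inl rfl) (hmax b hb) h
    · refine ⟨a, .inr ha, ?_⟩
      rintro b (rfl | hb)
      · exact h
      · exact hmax b hb

namespace ModuleTermOrder

variable {τ : ModuleTermOrder mo m}

lemma lt_of_le_of_lt {u v w : Term n m} (h₁ : τ.le u v) (h₂ : τ.lt v w) : τ.lt u w :=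
  ⟨τ.trans _ _ _ h₁ h₂.1, fun h => h₂.2 (τ.antisymm _ _ h₂.1 (h ▸ h₁))⟩

lemma lt_of_lt_of_le {u v w : Term n m} (h₁ : τ.lt u v) (h₂ : τ.le v w) : τ.lt u w :=
  ⟨τ.trans _ _ _ h₁.1 h₂, fun h => h₁.2 (τ.antisymm _ _ h₁.1 (h ▸ h₂))⟩

lemma lt_trans {u v w : Term n m} (h₁ : τ.lt u v) (h₂ : τ.lt v w) : τ.lt u w :=
  lt_of_lt_of_le h₁ h₂.1

lemma lt_irrefl (u : Term n m) : ¬ τ.lt u u := fun h => h.2 rfl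

lemma not_lt_of_le {u v : Term n m} (h : τ.le u v) : ¬ τ.lt v u :=
  fun h' => lt_irrefl _ (lt_of_lt_of_le h' h)

lemma le_or_lt (u v : Term n m) : τ.le u v ∨ τ.lt v u := by
  by_cases h : τ.le u v
  · exact .inl h
  · refine .inr ⟨(τ.total u v).resolve_left h, ?_⟩
    rintro rfl
    exact h (τ.refl _)

lemma le_of_not_lt {u v : Term n m} (h : ¬ τ.lt v u) : τ.le u v := (le_or_lt u v).resolve_right h

lemma lt_or_gt_of_ne {u v : Term n m} (h : u ≠ v) : τ.lt u v ∨ τ.lt v u :=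
  (τ.total u v).imp (fun h' => ⟨h', h⟩) (fun h' => ⟨h', h.symm⟩)

lemma mul_lt_mul_iff (t : PP n) {u v : Term n m} :
    τ.lt (Term.mul t u) (Term.mul t v) ↔ τ.lt u v := by
  constructor
  · intro h
    refine (le_or_lt v u).resolve_left fun h' => ?_
    exact not_lt_of_le (τ.mul_mono t _ _ h') h
  · exact fun h => ⟨τ.mul_mono t _ _ h.1, fun h' => h.2 (Term.mul_injective t h')⟩

lemma mul_le_mul_right {s t : PP n} (h : s ≼[mo] t) (u : Term n m) :
    τ.le (Term.mul s u) (Term.mul t u) := by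
  refine τ.compatible _ _ _ ?_
  simpa [map_add] using h

lemma mul_lt_mul_right {s t : PP n} (h : s ≺[mo] t) (u : Term n m) :
    τ.lt (Term.mul s u) (Term.mul t u) := by
  refine ⟨mul_le_mul_right h.le u, fun h' => h.ne ?_⟩
  have := congrArg Prod.fst h'
  simp only [Term.mul, add_left_inj] at this
  rw [this]

lemma le_mul (t : PP n) (u : Term n m) : τ.le u (Term.mul t u) := by
  have := mul_le_mul_right (τ := τ) (s := 0) (t := t) (by simp) u
  simpa using this

lemma le_of_dvd {u v : Term n m} (h : Term.Dvd u v) : τ.le u v := by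
  obtain ⟨t, rfl⟩ := h
  exact le_mul t u

lemma le_iff_of_eq (s t : PP n) (i : Fin m) : τ.le (s, i) (t, i) ↔ s ≼[mo] t := by
  refine ⟨fun h => ?_, τ.compatible s t i⟩
  by_contra hlt
  have h' := τ.antisymm _ _ h (τ.compatible t s i (not_le.1 hlt).le)
  simp only [Prod.mk.injEq, and_true] at h'
  exact hlt (by rw [h'])

/-- A compatible term order is a well-order, because there are finitely many components and the
admissible order is a well-order. -/
lemma wellFounded_lt (τ : ModuleTermOrder mo m) : WellFounded τ.lt := by
  rw [WellFounded.wellFounded_iff_has_min]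
  intro A hA
  -- The elements of `A` that are smallest in their component.
  set C : Set (Term n m) := {u ∈ A | ∀ s, (s, u.2) ∈ A → u.1 ≼[mo] s} with hC
  have hfin : C.Finite := by
    refine Set.Finite.of_finite_image (f := Prod.snd) (Set.toFinite _) ?_
    rintro ⟨s, i⟩ hs ⟨t, j⟩ ht (rfl : i = j)
    have := mo.toSyn.injective (le_antisymm (hs.2 t ht.1) (ht.2 s hs.1))
    simp [show s = t from this]
  have hmin : ∀ u ∈ A, ∃ v ∈ C, τ.le v u := by
    rintro ⟨s, i⟩ hs
    obtain ⟨t, ht, hmin⟩ := (InvImage.wf mo.toSyn _root_.wellFounded_lt).has_min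
      {t : PP n | (t, i) ∈ A} ⟨s, hs⟩
    have hmin' : ∀ x, (x, i) ∈ A → t ≼[mo] x := fun x hx => not_lt.1 (hmin x hx)
    exact ⟨(t, i), ⟨ht, hmin'⟩, τ.compatible _ _ _ (hmin' s hs)⟩
  obtain ⟨u, hu⟩ := hA
  obtain ⟨v, hv, -⟩ := hmin u hu
  obtain ⟨a, ha, hle⟩ := exists_greatest_of_finite hfin ⟨v, hv⟩ (fun x y => τ.le y x)
    (fun a _ b _ c _ h₁ h₂ => τ.trans _ _ _ h₂ h₁) (fun a _ b _ => τ.total b a)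
  refine ⟨a, ha.1, fun x hx => ?_⟩
  obtain ⟨y, hy, hyx⟩ := hmin x hx
  exact not_lt_of_le (τ.trans _ _ _ (hle y hy) hyx)

end ModuleTermOrder

/-! ### Signatures -/

variable {τ : ModuleTermOrder mo m} {F : Fin m → MvPolynomial (Fin n) K}

lemma mem_termSupp {a : FreeMod n m K} {u : Term n m} :
    u ∈ termSupp a ↔ (a u.2).coeff u.1 ≠ 0 := by
  simp [termSupp]

lemma termSupp_finite (a : FreeMod n m K) : (termSupp a).Finite := by
  have : termSupp a ⊆ ⋃ i : Fin m, (fun s => (s, i)) '' ((a i).support : Set (PP n)) := by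
    rintro ⟨s, i⟩ h
    exact Set.mem_iUnion.2 ⟨i, s, h, rfl⟩
  exact (Set.finite_iUnion fun i => (Finset.finite_toSet _).image _).subset this

lemma termSupp_nonempty {a : FreeMod n m K} (ha : a ≠ 0) : (termSupp a).Nonempty := by
  obtain ⟨i, hi⟩ := Function.ne_iff.1 ha
  obtain ⟨s, hs⟩ := MvPolynomial.ne_zero_iff.1 hi
  exact ⟨(s, i), mem_termSupp.2 hs⟩

lemma exists_isSig (τ : ModuleTermOrder mo m) {a : FreeMod n m K} (ha : a ≠ 0) :
    ∃ u, IsSig τ a u := by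
  obtain ⟨u, hu, hmax⟩ := exists_greatest_of_finite (termSupp_finite a) (termSupp_nonempty ha) τ.le
    (fun _ _ _ _ _ _ => τ.trans _ _ _) (fun _ _ _ _ => τ.total _ _)
  exact ⟨u, hu, hmax⟩

lemma IsSig.unique {a : FreeMod n m K} {u v : Term n m} (hu : IsSig τ a u) (hv : IsSig τ a v) :
    u = v :=
  τ.antisymm _ _ (hv.2 _ hu.1) (hu.2 _ hv.1)

lemma IsSig.neg {a : FreeMod n m K} {u : Term n m} (h : IsSig τ a u) : IsSig τ (-a) u := by
  have : termSupp (-a) = termSupp a := by ext; simp [mem_termSupp]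
  simpa only [IsSig, this] using h

/-- All terms of `a` are smaller than `u`: either `a = 0` or the signature of `a` is smaller
than `u`. -/
def SigLT (τ : ModuleTermOrder mo m) (a : FreeMod n m K) (u : Term n m) : Prop :=
  ∀ v ∈ termSupp a, τ.lt v u

lemma SigLT.lt_of_isSig {a : FreeMod n m K} {u v : Term n m} (h : SigLT τ a v) (hu : IsSig τ a u) :
    τ.lt u v := h u hu.1

lemma termSupp_sub {a b : FreeMod n m K} {v : Term n m} (h : v ∈ termSupp (a - b)) :
    v ∈ termSupp a ∨ v ∈ termSupp b := by
  simp only [mem_termSupp, Pi.sub_apply, MvPolynomial.coeff_sub] at h ⊢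
  by_contra! h'
  exact h (by rw [h'.1, h'.2, sub_zero])

lemma SigLT.sub {a b : FreeMod n m K} {u : Term n m} (ha : SigLT τ a u) (hb : SigLT τ b u) :
    SigLT τ (a - b) u := fun v hv => (termSupp_sub hv).elim (ha v) (hb v)

lemma IsSig.sub_sigLT {a b : FreeMod n m K} {u : Term n m} (ha : IsSig τ a u)
    (hb : SigLT τ b u) : IsSig τ (a - b) u := by
  have hbu : (b u.2).coeff u.1 = 0 := by
    by_contra h
    exact ModuleTermOrder.lt_irrefl _ (hb u (mem_termSupp.2 h))
  refine ⟨?_, fun v hv => (termSupp_sub hv).elim (ha.2 v) fun h => (hb v h).1⟩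
  have := mem_termSupp.1 ha.1
  simpa [mem_termSupp, hbu] using this

lemma termSupp_monomial_smul {a : FreeMod n m K} {t : PP n} {c : K} {v : Term n m}
    (h : v ∈ termSupp (MvPolynomial.monomial t c • a)) : ∃ u ∈ termSupp a, v = Term.mul t u := by
  obtain ⟨s, i⟩ := v
  simp only [mem_termSupp, Pi.smul_apply, smul_eq_mul, MvPolynomial.coeff_monomial_mul'] at h
  split_ifs at h with hts
  · exact ⟨(s - t, i), mem_termSupp.2 (right_ne_zero_of_mul h), by
      simp [Term.mul, add_tsub_cancel_of_le hts]⟩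
  · exact absurd rfl h

lemma IsSig.monomial_smul {a : FreeMod n m K} {u : Term n m} (h : IsSig τ a u) (t : PP n) {c : K}
    (hc : c ≠ 0) : IsSig τ (MvPolynomial.monomial t c • a) (Term.mul t u) := by
  refine ⟨?_, fun v hv => ?_⟩
  · have := mem_termSupp.1 h.1
    simp [mem_termSupp, Term.mul, MvPolynomial.coeff_monomial_mul, hc, this]
  · obtain ⟨w, hw, rfl⟩ := termSupp_monomial_smul hv
    exact τ.mul_mono t _ _ (h.2 w hw)

lemma IsSig.sigLT_monomial_smul {a : FreeMod n m K} {u v : Term n m} (h : IsSig τ a u) (t : PP n)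
    (c : K) (huv : τ.lt (Term.mul t u) v) : SigLT τ (MvPolynomial.monomial t c • a) v := by
  intro w hw
  obtain ⟨x, hx, rfl⟩ := termSupp_monomial_smul hw
  exact ModuleTermOrder.lt_of_le_of_lt (τ.mul_mono t _ _ (h.2 x hx)) huv

/-- Two elements with the same signature: some multiple of the second cancels the leading term
of the first. -/
lemma IsSig.exists_sub_sigLT {a b : FreeMod n m K} {u : Term n m} (ha : IsSig τ a u)
    (hb : IsSig τ b u) : ∃ c : K, c ≠ 0 ∧ 
    SigLT τ (a - MvPolynomial.monomial (0 : PP n) c • b) u := by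
  have ha' := mem_termSupp.1 ha.1
  have hb' := mem_termSupp.1 hb.1
  refine ⟨(a u.2).coeff u.1 / (b u.2).coeff u.1, div_ne_zero ha' hb', fun v hv => ⟨?_, ?_⟩⟩
  · refine (termSupp_sub hv).elim (ha.2 v) fun h => ?_
    obtain ⟨w, hw, rfl⟩ := termSupp_monomial_smul h
    simpa using hb.2 w hw
  · rintro rfl
    refine mem_termSupp.1 hv ?_
    have h0 := MvPolynomial.coeff_monomial_mul v.1 0 ((a v.2).coeff v.1 / (b v.2).coeff v.1)
      (b v.2)
    rw [zero_add] at h0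
    rw [Pi.sub_apply, MvPolynomial.coeff_sub, Pi.smul_apply, smul_eq_mul, h0]
    field_simp
    simp

/-! ### The map to the polynomial ring -/

@[simp] lemma bar_zero : bar F 0 = 0 := by simp [bar]

lemma bar_sub (a b : FreeMod n m K) : bar F (a - b) = bar F a - bar F b := by
  simp [bar, sub_mul]

lemma bar_smul (p : MvPolynomial (Fin n) K) (a : FreeMod n m K) :
    bar F (p • a) = p * bar F a := by
  simp [bar, Finset.mul_sum, mul_assoc]

@[simp] lemma bar_basisVec (i : Fin m) : bar F (basisVec n K i) = F i := by
  simp [bar, basisVec, Pi.single_apply]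

lemma ne_zero_of_bar_ne_zero {a : FreeMod n m K} (h : bar F a ≠ 0) : a ≠ 0 := by
  rintro rfl
  simp at h

lemma isSig_basisVec (i : Fin m) : IsSig τ (basisVec n K i) (0, i) := by
  refine ⟨by simp [mem_termSupp, basisVec], fun v hv => ?_⟩
  obtain ⟨s, j⟩ := v
  rw [mem_termSupp] at hv
  by_cases hj : j = i
  · subst hj
    have : s = 0 := by
      by_contra hs
      exact hv (by simp [basisVec, MvPolynomial.coeff_one, Ne.symm hs])
    rw [this]
    exact τ.refl _
  · exact absurd (by simp [basisVec, hj]) hv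

lemma degree_monomial_mul_le (t : PP n) (c : K) (q : MvPolynomial (Fin n) K) :
    mo.degree (MvPolynomial.monomial t c * q) ≼[mo] t + mo.degree q :=
  mo.degree_mul_le.trans <| by
    rw [map_add, map_add]
    exact add_le_add_left (mo.degree_monomial_le c) _

lemma coeff_monomial_mul_eq_zero {t v : PP n} (c : K) {q : MvPolynomial (Fin n) K}
    (h : t + mo.degree q ≺[mo] v) : (MvPolynomial.monomial t c * q).coeff v = 0 :=
  mo.coeff_eq_zero_of_lt ((degree_monomial_mul_le t c q).trans_lt h)

/-! ### Reducers and regular normal forms -/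

/-- `G` contains an element `g` with a multiple `t g` whose signature is smaller than `u` and whose
image has leading power-product `v`. -/
def HasReducer (τ : ModuleTermOrder mo m) (F : Fin m → MvPolynomial (Fin n) K)
    (G : Set (FreeMod n m K)) (u : Term n m) (v : PP n) : Prop :=
  ∃ g ∈ G, ∃ t w, IsSig τ g w ∧ bar F g ≠ 0 ∧ t + mo.degree (bar F g) = v ∧
    τ.lt (Term.mul t w) u

lemma exists_regTopRed_iff {G : Set (FreeMod n m K)} {a : FreeMod n m K} {u : Term n m}
    (ha : IsSig τ a u) (h0 : bar F a ≠ 0) :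
    (∃ c, RegTopRed τ F G a c) ↔ HasReducer τ F G u (mo.degree (bar F a)) := by
  constructor
  · rintro ⟨c, g, hg, t, hg0, -, -, ⟨w, v, hw, hv, hlt⟩, hdeg⟩
    obtain rfl := ha.unique hv
    exact ⟨g, hg, t, w, hw, hg0, hdeg, hlt⟩
  · rintro ⟨g, hg, t, w, hw, hg0, hdeg, hlt⟩
    exact ⟨_, g, hg, t, hg0, hdeg ▸ mo.degree_mem_support h0, rfl, ⟨w, u, hw, ha, hlt⟩, hdeg⟩

lemma exists_regRed_iff {G : Set (FreeMod n m K)} {a : FreeMod n m K} {u : Term n m}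
    (ha : IsSig τ a u) :
    (∃ c, RegRed τ F G a c) ↔ ∃ v ∈ (bar F a).support, HasReducer τ F G u v := by
  constructor
  · rintro ⟨c, g, hg, t, hg0, hmem, -, ⟨w, v, hw, hv, hlt⟩, -⟩
    obtain rfl := ha.unique hv
    exact ⟨_, hmem, g, hg, t, w, hw, hg0, rfl, hlt⟩
  · rintro ⟨v, hv, g, hg, t, w, hw, hg0, rfl, hlt⟩
    exact ⟨_, g, hg, t, hg0, hv, rfl, ⟨w, u, hw, ha, hlt⟩, mo.le_degree hv⟩

lemma RegRed.genRed {G : Set (FreeMod n m K)} {a b : FreeMod n m K} (h : RegRed τ F G a b) :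
    GenRed τ F G a b := by
  obtain ⟨g, hg, t, hg0, hmem, hb, ⟨w, v, hw, hv, hlt⟩, hle⟩ := h
  exact ⟨g, hg, t, hg0, hmem, hb, ⟨w, v, hw, hv, hlt.1⟩, hle⟩

lemma RegRed.isSig {G : Set (FreeMod n m K)} {a b : FreeMod n m K} {u : Term n m}
    (h : RegRed τ F G a b) (ha : IsSig τ a u) : IsSig τ b u := by
  obtain ⟨g, hg, t, hg0, hmem, rfl, ⟨w, v, hw, hv, hlt⟩, hle⟩ := h
  obtain rfl := ha.unique hv
  exact ha.sub_sigLT (hw.sigLT_monomial_smul t _ hlt)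

lemma RegRed.degree_le {G : Set (FreeMod n m K)} {a b : FreeMod n m K}
    (h : RegRed τ F G a b) : mo.degree (bar F b) ≼[mo] mo.degree (bar F a) := by
  obtain ⟨g, hg, t, hg0, hmem, rfl, -, hle⟩ := h
  rw [bar_sub, bar_smul]
  exact mo.degree_sub_le.trans (sup_le le_rfl ((degree_monomial_mul_le ..).trans hle))

lemma IsRegNormalForm.isSig {G : Set (FreeMod n m K)} {a b : FreeMod n m K} {u : Term n m}
    (h : IsRegNormalForm τ F G a b) (ha : IsSig τ a u) : IsSig τ b u := by
  obtain ⟨h, -⟩ := h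
  induction h with
  | refl => exact ha
  | tail _ h ih => exact h.isSig ih

lemma IsRegNormalForm.degree_le {G : Set (FreeMod n m K)} {a b : FreeMod n m K}
    (h : IsRegNormalForm τ F G a b) : mo.degree (bar F b) ≼[mo] mo.degree (bar F a) := by
  obtain ⟨h, -⟩ := h
  induction h with
  | refl => exact le_rfl
  | tail _ h ih => exact h.degree_le.trans ih

lemma IsRegNormalForm.not_hasReducer {G : Set (FreeMod n m K)} {a b : FreeMod n m K}
    {u : Term n m} (h : IsRegNormalForm τ F G a b) (ha : IsSig τ a u) (hb : bar F b ≠ 0) :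
    ¬ HasReducer τ F G u (mo.degree (bar F b)) := fun h' => by
  obtain ⟨c, hc⟩ := (exists_regRed_iff (h.isSig ha)).2 ⟨_, mo.degree_mem_support hb, h'⟩
  exact h.2 c hc

/-- Every element with a signature has a regular normal form: when always the largest reducible
power-product is eliminated, these power-products form a decreasing sequence. -/
lemma exists_isRegNormalForm (G : Set (FreeMod n m K)) {a : FreeMod n m K} {u : Term n m}
    (ha : IsSig τ a u) : ∃ b, IsRegNormalForm τ F G a b := by
  have key : ∀ d : mo.syn, ∀ a, IsSig τ a u → ∀ v ∈ (bar F a).support, mo.toSyn v = d →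
      HasReducer τ F G u v →
      (∀ v' ∈ (bar F a).support, HasReducer τ F G u v' → v' ≼[mo] v) →
      ∃ b, IsRegNormalForm τ F G a b := by
    intro d
    induction d using WellFoundedLT.induction with
    | ind d ih =>
    rintro a ha v hv rfl ⟨g, hg, t, w, hw, hg0, rfl, hlt⟩ hmax
    set c := (bar F a).coeff (t + mo.degree (bar F g)) / mo.leadingCoeff (bar F g) with hc
    set a' := a - MvPolynomial.monomial t c • g with ha'
    have hstep : RegRed τ F G a a' :=
      ⟨g, hg, t, hg0, hv, rfl, ⟨w, u, hw, ha, hlt⟩, mo.le_degree hv⟩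
    have hsig := hstep.isSig ha
    have hlow : ∀ v' ∈ (bar F a').support, HasReducer τ F G u v' →
        v' ≺[mo] t + mo.degree (bar F g) := by
      intro v' hv' hred
      by_contra hnot
      rcases (not_lt.1 hnot).eq_or_lt with heq | hgt
      · obtain rfl := mo.toSyn.injective heq
        refine MvPolynomial.mem_support_iff.1 hv' ?_
        rw [ha', bar_sub, bar_smul, MvPolynomial.coeff_sub, MvPolynomial.coeff_monomial_mul,
          ← MonomialOrder.leadingCoeff, hc,
          div_mul_cancel₀ _ (mo.leadingCoeff_ne_zero_iff.2 hg0), sub_self]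
      · have : v' ∈ (bar F a).support := by
          rw [MvPolynomial.mem_support_iff, ha', bar_sub, bar_smul, MvPolynomial.coeff_sub,
            coeff_monomial_mul_eq_zero _ hgt, sub_zero] at hv'
          exact MvPolynomial.mem_support_iff.2 hv'
        exact absurd (hmax v' this hred) (not_le.2 hgt)
    by_cases hne : ∃ v' ∈ (bar F a').support, HasReducer τ F G u v'
    · obtain ⟨v', ⟨hv', hred'⟩, hmax'⟩ := exists_greatest_of_finite
        (s := {v' | v' ∈ (bar F a').support ∧ HasReducer τ F G u v'})
        ((Finset.finite_toSet (bar F a').support).subset fun x hx => hx.1) hne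
        (fun x y => x ≼[mo] y) (fun _ _ _ _ _ _ => le_trans) (fun _ _ _ _ => le_total _ _)
      obtain ⟨b, hb, hb'⟩ := ih _ (hlow v' hv' hred') a' hsig v' hv' rfl hred'
        fun x hx hx' => hmax' x ⟨hx, hx'⟩
      exact ⟨b, .head hstep hb, hb'⟩
    · refine ⟨a', .single hstep, fun b hb => hne ?_⟩
      exact (exists_regRed_iff hsig).1 ⟨b, hb⟩
  by_cases hne : ∃ v ∈ (bar F a).support, HasReducer τ F G u v
  · obtain ⟨v, ⟨hv, hred⟩, hmax⟩ := exists_greatest_of_finite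
      (s := {v | v ∈ (bar F a).support ∧ HasReducer τ F G u v})
      ((Finset.finite_toSet (bar F a).support).subset fun x hx => hx.1) hne
      (fun x y => x ≼[mo] y) (fun _ _ _ _ _ _ => le_trans) (fun _ _ _ _ => le_total _ _)
    exact key _ a ha v hv rfl hred fun x hx hx' => hmax x ⟨hx, hx'⟩
  · exact ⟨a, .refl, fun b hb => hne ((exists_regRed_iff ha).1 ⟨b, hb⟩)⟩

/-! ### Signature Gröbner bases -/

lemma IsSigGBUpTo.sRedZero {G : Set (FreeMod n m K)} {u : Term n m} (h : IsSigGBUpTo τ F G u)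
    {a : FreeMod n m K} (ha : SigLT τ a u) : SRedZero τ F G a := by
  rcases eq_or_ne a 0 with rfl | h0
  · exact ⟨0, .refl, by simp⟩
  · obtain ⟨v, hv⟩ := exists_isSig τ h0
    exact h v (ha.lt_of_isSig hv) a hv

lemma GenRed.sigLT {G : Set (FreeMod n m K)} {a b : FreeMod n m K} {u : Term n m}
    (h : GenRed τ F G a b) (ha : SigLT τ a u) : SigLT τ b u := by
  obtain ⟨g, hg, t, hg0, hmem, rfl, ⟨w, v, hw, hv, hle⟩, -⟩ := h
  exact ha.sub (hw.sigLT_monomial_smul t _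
    (ModuleTermOrder.lt_of_le_of_lt hle (ha.lt_of_isSig hv)))

/-- The leading power-product of an element that reduces to zero is removed by one of the steps. -/
lemma SRedZero.hasReducer {G : Set (FreeMod n m K)} {a : FreeMod n m K} {u : Term n m}
    (h : SRedZero τ F G a) (ha : SigLT τ a u) (h0 : bar F a ≠ 0) :
    HasReducer τ F G u (mo.degree (bar F a)) := by
  obtain ⟨b, hb, hb0⟩ := h
  induction hb using Relation.ReflTransGen.head_induction_on with
  | refl => exact absurd hb0 h0
  | @head a a' h _ ih =>
    have ha' := h.sigLT ha
    obtain ⟨g, hg, t, hg0, hmem, rfl, ⟨w, v, hw, hv, hle⟩, hdeg⟩ := h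
    rcases hdeg.eq_or_lt with heq | hlt
    · exact ⟨g, hg, t, w, hw, hg0, mo.toSyn.injective heq,
        ModuleTermOrder.lt_of_le_of_lt hle (ha.lt_of_isSig hv)⟩
    · have hd := mo.degree_sub_of_lt ((degree_monomial_mul_le t
        ((bar F a).coeff (t + mo.degree (bar F g)) / mo.leadingCoeff (bar F g))
        (bar F g)).trans_lt hlt)
      rw [← bar_smul, ← bar_sub] at hd
      rw [← hd]
      refine ih ha' fun hz => ?_
      rw [hz, mo.degree_zero] at hd
      rw [← hd, map_zero] at hlt
      exact absurd hlt (not_lt.2 (mo.zero_le _))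

/-- A reduction to zero also applies to an element with the same image and a larger signature. -/
lemma SRedZero.of_bar_eq {G : Set (FreeMod n m K)} {a a' : FreeMod n m K} {u : Term n m}
    (h : SRedZero τ F G a') (ha' : SigLT τ a' u) (ha : IsSig τ a u) (hbar : bar F a = bar F a') :
    SRedZero τ F G a := by
  obtain ⟨b, hb, hb0⟩ := h
  induction hb using Relation.ReflTransGen.head_induction_on generalizing a with
  | refl => exact ⟨a, .refl, hbar.trans hb0⟩
  | @head a' a'' h _ ih =>
    have ha'' := h.sigLT ha'
    obtain ⟨g, hg, t, hg0, hmem, rfl, ⟨w, v, hw, hv, hle⟩, hdeg⟩ := h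
    have hlt := ModuleTermOrder.lt_of_le_of_lt hle (ha'.lt_of_isSig hv)
    set c := (bar F a').coeff (t + mo.degree (bar F g)) / mo.leadingCoeff (bar F g) with hc
    obtain ⟨d, hd, hd0⟩ := ih ha'' (a := a - MvPolynomial.monomial t c • g)
      (ha.sub_sigLT (hw.sigLT_monomial_smul t _ hlt)) (by rw [bar_sub, bar_sub, hbar])
    refine ⟨d, .head ⟨g, hg, t, hg0, hbar ▸ hmem, ?_, ⟨w, u, hw, ha, hlt.1⟩, hbar ▸ hdeg⟩ hd, hd0⟩
    rw [hbar]

lemma SRedZero.of_reflTransGen {G : Set (FreeMod n m K)} {a b : FreeMod n m K}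
    (h : Relation.ReflTransGen (GenRed τ F G) a b) (hb : SRedZero τ F G b) :
    SRedZero τ F G a := by
  obtain ⟨c, hc, hc0⟩ := hb
  exact ⟨c, h.trans hc, hc0⟩

/-- `u` is the signature of a syzygy. -/
def IsSyzSig (τ : ModuleTermOrder mo m) (F : Fin m → MvPolynomial (Fin n) K) (u : Term n m) :
    Prop := ∃ h : FreeMod n m K, bar F h = 0 ∧ IsSig τ h u

lemma IsSyzSig.of_dvd {u v : Term n m} (h : IsSyzSig τ F u) (huv : Term.Dvd u v) :
    IsSyzSig τ F v := by
  obtain ⟨a, ha, hsig⟩ := h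
  obtain ⟨t, rfl⟩ := huv
  exact ⟨MvPolynomial.monomial t 1 • a, by rw [bar_smul, ha, mul_zero],
    hsig.monomial_smul t one_ne_zero⟩

/-- An element which is not regular top reducible has the least leading power-product among all
elements with its signature; in particular, that signature is not the one of a syzygy. -/
lemma IsSigGBUpTo.degree_le {G : Set (FreeMod n m K)} {u : Term n m} (hG : IsSigGBUpTo τ F G u)
    {b e : FreeMod n m K} (hb : IsSig τ b u) (hb0 : bar F b ≠ 0)
    (hirr : ¬ HasReducer τ F G u (mo.degree (bar F b))) (he : IsSig τ e u) :
    bar F e ≠ 0 ∧ mo.degree (bar F b) ≼[mo] mo.degree (bar F e) := by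
  by_contra hcon
  obtain ⟨c, hc, hlt⟩ := hb.exists_sub_sigLT he
  -- Otherwise, cancelling the leading terms does not affect the leading power-product of `b`.
  have hd : mo.degree (bar F (b - MvPolynomial.monomial (0 : PP n) c • e)) = mo.degree (bar F b) ∧
      bar F (b - MvPolynomial.monomial (0 : PP n) c • e) ≠ 0 := by
    rw [bar_sub, bar_smul]
    by_cases he0 : bar F e = 0
    · simp [he0, hb0]
    · have hlt' : mo.degree (bar F e) ≺[mo] mo.degree (bar F b) := by
        by_contra h
        exact hcon ⟨he0, not_lt.1 h⟩
      have hlt'' : mo.degree (MvPolynomial.monomial (0 : PP n) c * bar F e) ≺[mo]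
          mo.degree (bar F b) := by
        refine (degree_monomial_mul_le _ _ _).trans_lt ?_
        simpa using hlt'
      refine ⟨mo.degree_sub_of_lt hlt'', fun h => ?_⟩
      have h2 := mo.degree_sub_of_lt hlt''
      rw [h, mo.degree_zero] at h2
      rw [← h2, map_zero] at hlt''
      exact absurd hlt'' (not_lt.2 (mo.zero_le _))
  exact hirr (hd.1 ▸ (hG.sRedZero hlt).hasReducer hlt hd.2)

lemma IsSigGBUpTo.not_isSyzSig {G : Set (FreeMod n m K)} {u : Term n m}
    (hG : IsSigGBUpTo τ F G u) {b : FreeMod n m K} (hb : IsSig τ b u) (hb0 : bar F b ≠ 0)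
    (hirr : ¬ HasReducer τ F G u (mo.degree (bar F b))) : ¬ IsSyzSig τ F u :=
  fun ⟨_, h0, hsig⟩ => (hG.degree_le hb hb0 hirr hsig).1 h0

lemma degree_bar_monomial_smul (t : PP n) {c : K} (hc : c ≠ 0) {a : FreeMod n m K}
    (ha : bar F a ≠ 0) :
    mo.degree (bar F (MvPolynomial.monomial t c • a)) = t + mo.degree (bar F a) ∧
      bar F (MvPolynomial.monomial t c • a) ≠ 0 := by
  classical
  have : MvPolynomial.monomial t c ≠ 0 := by simpa using hc
  rw [bar_smul, mo.degree_mul this ha, mo.degree_monomial, if_neg hc]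
  exact ⟨rfl, mul_ne_zero this ha⟩

/-- At a syzygy signature, subtracting a multiple of the syzygy lowers the signature without
changing the image. -/
lemma isSigGBIn_of_isSyzSig {G : Set (FreeMod n m K)} {u : Term n m} (hG : IsSigGBUpTo τ F G u)
    (h : IsSyzSig τ F u) : IsSigGBIn τ F G u := by
  intro a ha
  obtain ⟨s, hs0, hs⟩ := h
  obtain ⟨c, -, hlt⟩ := ha.exists_sub_sigLT hs
  refine (hG.sRedZero hlt).of_bar_eq hlt ha ?_
  rw [bar_sub, bar_smul, hs0, mul_zero, sub_zero]

/-- If some multiple `t r` of a basis element `r` has signature `u` and is not regular top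
reducible, then every element with signature `u` is, after regular reduction, top reduced by `t r`
to an element with smaller signature. -/
lemma isSigGBIn_of_not_hasReducer {G : Set (FreeMod n m K)} {u w : Term n m} {t : PP n}
    {r : FreeMod n m K} (hG : IsSigGBUpTo τ F G u) (hr : r ∈ G) (hr0 : bar F r ≠ 0)
    (hw : IsSig τ r w) (hu : u = Term.mul t w)
    (hirr : ¬ HasReducer τ F G u (t + mo.degree (bar F r))) : IsSigGBIn τ F G u := by
  intro a ha
  obtain ⟨b, hnf⟩ := exists_isRegNormalForm (F := F) G ha
  have hb := hnf.isSig ha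
  refine SRedZero.of_reflTransGen
    (Relation.ReflTransGen.mono (fun _ _ => RegRed.genRed) _ _ hnf.1) ?_
  by_cases hb0 : bar F b = 0
  · exact ⟨b, .refl, hb0⟩
  have hbirr := hnf.not_hasReducer ha hb0
  set r' : FreeMod n m K := MvPolynomial.monomial t (1 : K) • r with hr'
  have hsig' : IsSig τ r' u := hu ▸ hw.monomial_smul t one_ne_zero
  obtain ⟨hdeg', hr'0⟩ := degree_bar_monomial_smul (mo := mo) t (one_ne_zero (α := K)) hr0
  rw [← hr'] at hdeg' hr'0
  have hdeg : mo.degree (bar F b) = mo.degree (bar F r') := mo.toSyn.injective <| le_antisymm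
    (hG.degree_le hb hb0 hbirr hsig').2
    (hG.degree_le hsig' hr'0 (by rwa [hdeg']) hb).2
  obtain ⟨c, hc, hlt⟩ := hb.exists_sub_sigLT hsig'
  set d := b - MvPolynomial.monomial (0 : PP n) c • r' with hd
  -- The scalar that cancels the signatures also cancels the leading power-products.
  have hcoeff : (bar F d).coeff (mo.degree (bar F b)) = 0 := by
    by_contra hne
    have hd0 : bar F d ≠ 0 := by
      intro h
      rw [h] at hne
      simp at hne
    have hle : mo.degree (bar F d) ≼[mo] mo.degree (bar F b) := by
      rw [hd, bar_sub, bar_smul]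
      refine mo.degree_sub_le.trans (sup_le le_rfl ((degree_monomial_mul_le ..).trans ?_))
      rw [zero_add, hdeg]
    have heq : mo.degree (bar F d) = mo.degree (bar F b) := mo.toSyn.injective <|
      le_antisymm hle (mo.le_degree (MvPolynomial.mem_support_iff.2 hne))
    exact hbirr (heq ▸ (hG.sRedZero hlt).hasReducer hlt hd0)
  have hd' : d = b - MvPolynomial.monomial t c • r := by
    rw [hd, hr', smul_smul, MvPolynomial.monomial_mul, zero_add, mul_one]
  have hlc : (bar F b).coeff (t + mo.degree (bar F r)) / mo.leadingCoeff (bar F r) = c := by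
    rw [hdeg, hdeg', hd', bar_sub, bar_smul, MvPolynomial.coeff_sub,
      MvPolynomial.coeff_monomial_mul, sub_eq_zero] at hcoeff
    rw [hcoeff, MonomialOrder.leadingCoeff,
      mul_div_cancel_right₀ _ (mo.coeff_degree_ne_zero_iff.2 hr0)]
  have hdb : mo.degree (bar F b) = t + mo.degree (bar F r) := hdeg.trans hdeg'
  refine SRedZero.of_reflTransGen (.single ⟨r, hr, t, hr0, ?_, ?_, ⟨w, u, hw, hb, ?_⟩, ?_⟩)
    (hG.sRedZero hlt)
  · exact hdb ▸ mo.degree_mem_support hb0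
  · rw [hd', hlc]
  · rw [hu]
    exact τ.refl _
  · rw [hdb]

/-! ### S-pairs -/

lemma cofactor_add_degree (p q : MvPolynomial (Fin n) K) :
    cofactor mo p q + mo.degree p = mo.degree p ⊔ mo.degree q := by
  ext i
  simp only [cofactor, Finsupp.add_apply, Finsupp.tsub_apply, Finsupp.sup_apply]
  omega

lemma cofactor_add_degree_comm (p q : MvPolynomial (Fin n) K) :
    cofactor mo p q + mo.degree p = cofactor mo q p + mo.degree q := by
  rw [cofactor_add_degree, cofactor_add_degree, sup_comm]

/-- A common multiple of two leading power-products is a multiple of their least common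
multiple. -/
lemma exists_eq_add_cofactor {p q : MvPolynomial (Fin n) K} {s t : PP n}
    (h : t + mo.degree p = s + mo.degree q) :
    ∃ r, t = r + cofactor mo p q ∧ s = r + cofactor mo q p := by
  refine ⟨t + mo.degree p - (mo.degree p ⊔ mo.degree q), ?_, ?_⟩ <;> ext i <;>
  · have := DFunLike.congr_fun h i
    simp only [cofactor, Finsupp.add_apply, Finsupp.tsub_apply, Finsupp.sup_apply] at this ⊢
    omega

lemma IsSPairTerm.eq {a b : FreeMod n m K} {u w : Term n m} (h : IsSPairTerm τ F a b w)
    (hu : IsSig τ a u) : w = Term.mul (cofactor mo (bar F a) (bar F b)) u := by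
  obtain ⟨v, hv, rfl⟩ := h
  rw [hu.unique hv]

lemma IsSPairTerm.unique {a b : FreeMod n m K} {v w : Term n m} (hv : IsSPairTerm τ F a b v)
    (hw : IsSPairTerm τ F a b w) : v = w := by
  obtain ⟨u, hu, rfl⟩ := hv
  exact (hw.eq hu).symm

lemma IsRegularSPair.symm {a b : FreeMod n m K} (h : IsRegularSPair τ F a b) :
    IsRegularSPair τ F b a := by
  obtain ⟨ha, hb, u, v, hu, hv, hne⟩ := h
  exact ⟨hb, ha, v, u, hv, hu, hne.symm⟩

lemma not_isRegularSPair_self (a : FreeMod n m K) : ¬ IsRegularSPair τ F a a := by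
  rintro ⟨-, -, u, v, hu, hv, hne⟩
  exact hne (hu.unique hv)

lemma spair_swap (a b : FreeMod n m K) : spair mo F b a = -spair mo F a b := by
  simp [spair]

/-- The signature of a regular S-pair is the larger one of its two terms. -/
lemma isSig_spair {a b : FreeMod n m K} {u v : Term n m} (ha : bar F a ≠ 0)
    (hu : IsSPairTerm τ F a b u) (hv : IsSPairTerm τ F b a v) (hlt : τ.lt v u) :
    IsSig τ (spair mo F a b) u := by
  obtain ⟨x, hx, rfl⟩ := hu
  obtain ⟨y, hy, rfl⟩ := hv
  exact (hx.monomial_smul _ (inv_ne_zero (mo.leadingCoeff_ne_zero_iff.2 ha))).sub_sigLT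
    (hy.sigLT_monomial_smul _ _ hlt)

lemma isSig_spair' {a b : FreeMod n m K} {u v : Term n m} (hb : bar F b ≠ 0)
    (hu : IsSPairTerm τ F a b u) (hv : IsSPairTerm τ F b a v) (hlt : τ.lt u v) :
    IsSig τ (spair mo F a b) v := by
  rw [spair_swap b a]
  exact (isSig_spair hb hv hu hlt).neg

lemma IsRegularSPair.exists_isSig {a b : FreeMod n m K} (h : IsRegularSPair τ F a b) :
    ∃ u, IsSig τ (spair mo F a b) u := by
  obtain ⟨ha, hb, u, v, hu, hv, hne⟩ := h
  rcases ModuleTermOrder.lt_or_gt_of_ne hne with h | h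
  · exact ⟨v, isSig_spair' hb hu hv h⟩
  · exact ⟨u, isSig_spair ha hu hv h⟩

lemma IsRegularSPair.sig_eq_or {a b : FreeMod n m K} {u v w : Term n m} (h : IsRegularSPair τ F a b)
    (hw : IsSig τ (spair mo F a b) w) (hu : IsSPairTerm τ F a b u) (hv : IsSPairTerm τ F b a v) :
    (w = u ∧ τ.lt v u) ∨ (w = v ∧ τ.lt u v) := by
  obtain ⟨ha, hb, u', v', hu', hv', hne⟩ := h
  obtain rfl := hu.unique hu'
  obtain rfl := hv.unique hv'
  rcases ModuleTermOrder.lt_or_gt_of_ne hne with h | h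
  · exact .inr ⟨hw.unique (isSig_spair' hb hu hv h), h⟩
  · exact .inl ⟨hw.unique (isSig_spair ha hu hv h), h⟩

/-! ### The loop invariant -/

section

variable (τ F) (rwo : Term n m × MvPolynomial (Fin n) K → Term n m × MvPolynomial (Fin n) K → Prop)

/-- The S-pair of `a` and `b` need not be considered any more: it satisfies the discarding
criterion, or the basis contains an element with its signature. -/
def IsSettled (G : Set (FreeMod n m K)) (a b : FreeMod n m K) : Prop :=
  (∃ w, IsSPairTerm τ F a b w ∧ (IsSyzSig τ F w ∨ ¬ IsCanonRewriter τ F rwo G w a)) ∨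
  (∃ w, IsSPairTerm τ F b a w ∧ (IsSyzSig τ F w ∨ ¬ IsCanonRewriter τ F rwo G w b)) ∨
  ∃ w, IsSig τ (spair mo F a b) w ∧ ∃ g ∈ G, IsSig τ g w

/-- The ratio of signature and leading power-product is smaller for `a` than for `b`. The two ratios
are compared after multiplication by both leading power-products. -/
def RatioLT (a b : FreeMod n m K) : Prop :=
  ∃ u v, IsSig τ a u ∧ IsSig τ b v ∧
    τ.lt (Term.mul (mo.degree (bar F b)) u) (Term.mul (mo.degree (bar F a)) v)

/-- The invariant of the main loop of the algorithm, for a regular sequence and a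
position-over-term order. The fields `basis` and `settled` say that the basis vectors and regular
S-pairs which are no longer pending have been taken care of; `exists_dvd` says that `S` covers all
syzygy signatures in the components whose basis vector has been processed; `sig_injective` and
`origin` are what the proof of termination needs. -/
structure Invariant (st : State n m K) : Prop where
  finite_G : st.G.Finite
  finite_P : st.P.Finite
  bar_ne_zero : ∀ g ∈ st.G, bar F g ≠ 0
  irreducible : ∀ g ∈ st.G, ∀ w, IsSig τ g w → ¬ HasReducer τ F st.G w (mo.degree (bar F g))
  sig_le : ∀ g ∈ st.G, ∀ w, IsSig τ g w → ∀ p ∈ st.P, ∀ v, IsSig τ (p.toMod mo F) v → τ.le w v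
  basis : ∀ i, Pair.basis i ∈ st.P ∨ IsSyzSig τ F (0, i) ∨ ∃ g ∈ st.G, IsSig τ g (0, i)
  spair_mem : ∀ a b, Pair.spair a b ∈ st.P → a ∈ st.G ∧ b ∈ st.G ∧ IsRegularSPair τ F a b
  settled : ∀ a ∈ st.G, ∀ b ∈ st.G, IsRegularSPair τ F a b →
    Pair.spair a b ∈ st.P ∨ Pair.spair b a ∈ st.P ∨ IsSettled τ F rwo st.G a b
  isSyzSig : ∀ s ∈ st.S, IsSyzSig τ F s
  basis_notMem : ∀ g ∈ st.G, ∀ w, IsSig τ g w → Pair.basis w.2 ∉ st.P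
  exists_dvd : ∀ u, IsSyzSig τ F u → Pair.basis u.2 ∉ st.P → ∃ s ∈ st.S, Term.Dvd s u
  sig_injective : ∀ g ∈ st.G, ∀ g' ∈ st.G, ∀ w, IsSig τ g w → IsSig τ g' w → g = g'
  origin : ∀ g ∈ st.G, (∃ i, IsSig τ g (0, i)) ∨ ∃ c ∈ st.G, ∃ d ∈ st.G,
    RatioLT τ F c g ∧ RatioLT τ F d g ∧ ∃ w, IsSPairTerm τ F c d w ∧ IsSig τ g w
  counter : st.z = 0

/-- `u` is smaller than the signatures of all elements still to be considered. -/
def BelowPending (P : Set (Pair n m K)) (u : Term n m) : Prop :=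
  ∀ p ∈ P, ∀ v, IsSig τ (p.toMod mo F) v → τ.lt u v

/-- `u` is a syzygy signature, or the multiple with signature `u` of some canonical rewriter in `u`
is not regular top reducible. -/
def IsRewriteBasisIn (G : Set (FreeMod n m K)) (u : Term n m) : Prop :=
  IsSyzSig τ F u ∨ ∃ r w t, IsCanonRewriter τ F rwo G u r ∧ IsSig τ r w ∧ u = Term.mul t w ∧
    ¬ HasReducer τ F G u (t + mo.degree (bar F r))

end

variable {rwo : Term n m × MvPolynomial (Fin n) K → Term n m × MvPolynomial (Fin n) K → Prop}

lemma IsCanonRewriter.of_dvd {G : Set (FreeMod n m K)} {v w : Term n m} {a : FreeMod n m K}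
    (h : IsCanonRewriter τ F rwo G w a) (hvw : Term.Dvd v w) {u : Term n m} (hu : IsSig τ a u)
    (huv : Term.Dvd u v) : IsCanonRewriter τ F rwo G v a := by
  obtain ⟨ha, u', hu', -, hmax⟩ := h
  obtain rfl := hu.unique hu'
  exact ⟨ha, u, hu, huv, fun g hg x hx hxv => hmax g hg x hx (hxv.trans hvw)⟩

lemma IsCanonRewriter.anti {G G' : Set (FreeMod n m K)} (hG : G ⊆ G') {w : Term n m}
    {a : FreeMod n m K} (ha : a ∈ G) (h : IsCanonRewriter τ F rwo G' w a) :
    IsCanonRewriter τ F rwo G w a := by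
  obtain ⟨-, u, hu, huw, hmax⟩ := h
  exact ⟨ha, u, hu, huw, fun g hg => hmax g (hG hg)⟩

lemma IsSettled.mono {G G' : Set (FreeMod n m K)} (hG : G ⊆ G') {a b : FreeMod n m K}
    (ha : a ∈ G) (hb : b ∈ G) (h : IsSettled τ F rwo G a b) : IsSettled τ F rwo G' a b := by
  rcases h with ⟨w, hw, h⟩ | ⟨w, hw, h⟩ | ⟨w, hw, g, hg, h⟩
  · exact .inl ⟨w, hw, h.imp_right fun h h' => h (h'.anti hG ha)⟩
  · exact .inr (.inl ⟨w, hw, h.imp_right fun h h' => h (h'.anti hG hb)⟩)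
  · exact .inr (.inr ⟨w, hw, g, hG hg, h⟩)

lemma IsSettled.symm {G : Set (FreeMod n m K)} {a b : FreeMod n m K}
    (h : IsSettled τ F rwo G a b) : IsSettled τ F rwo G b a := by
  rcases h with h | h | ⟨w, hw, h⟩
  · exact .inr (.inl h)
  · exact .inl h
  · exact .inr (.inr ⟨w, by rw [spair_swap]; exact hw.neg, h⟩)

namespace Invariant

variable {st : State n m K}

lemma exists_isSig_of_mem (h : Invariant τ F rwo st) {g : FreeMod n m K} (hg : g ∈ st.G) :
    ∃ w, IsSig τ g w := exists_isSig τ (ne_zero_of_bar_ne_zero (h.bar_ne_zero g hg))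

lemma exists_isSig_toMod (h : Invariant τ F rwo st) {p : Pair n m K} (hp : p ∈ st.P) :
    ∃ u, IsSig τ (p.toMod mo F) u := by
  cases p with
  | basis i => exact ⟨_, isSig_basisVec i⟩
  | spair a b => exact (h.spair_mem a b hp).2.2.exists_isSig

/-- If the first element of an S-pair with signature `u` is a canonical rewriter in `u`, then the
basis contains no element with signature `u` yet: by the rewrite order such an element would have
the same signature as the canonical rewriter, which would be regular top reducible by the second
element of the S-pair. -/
lemma not_isSig_of_isCanonRewriter (h : Invariant τ F rwo st) (hrw : IsRewriteOrder τ F rwo)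
    {r d : FreeMod n m K} {u v : Term n m} (hr : r ∈ st.G) (hd : d ∈ st.G)
    (hu : IsSPairTerm τ F r d u) (hv : IsSPairTerm τ F d r v) (hlt : τ.lt v u)
    (hcan : IsCanonRewriter τ F rwo st.G u r) (hGB : IsSigGBUpTo τ F st.G u)
    {g : FreeMod n m K} (hg : g ∈ st.G) : ¬ IsSig τ g u := by
  intro hgu
  obtain ⟨-, w, hw, hwu, hmax⟩ := hcan
  have h₁ := hmax g hg u hgu (Term.Dvd.refl u)
  have h₂ := hrw.of_dvd st.G r g w u hr hg hw hgu hGB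
    (fun c hc => h.irreducible g hg u hgu
      ((exists_regTopRed_iff hgu (h.bar_ne_zero g hg)).1 ⟨c, hc⟩)) hwu
  obtain rfl : u = w := hrw.sig_eq _ _ ⟨g, hgu, rfl⟩ ⟨r, hw, rfl⟩ h₁ h₂
  obtain ⟨y, hy, rfl⟩ := hv
  have hc : cofactor mo (bar F r) (bar F d) = 0 := by
    have := congrArg Prod.fst (hu.eq hw)
    simpa [Term.mul] using this
  have hdeg := cofactor_add_degree_comm (mo := mo) (bar F r) (bar F d)
  rw [hc, zero_add] at hdeg
  exact h.irreducible r hr u hw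
    ⟨d, hd, _, y, hy, h.bar_ne_zero d hd, hdeg.symm, hlt⟩

lemma exists_isCanonRewriter (h : Invariant τ F rwo st) (hrw : IsRewriteOrder τ F rwo)
    {u : Term n m} (hu : BelowPending τ F st.P u) (hsyz : ¬ IsSyzSig τ F u) :
    ∃ r, IsCanonRewriter τ F rwo st.G u r := by
  have hdvd : Term.Dvd ((0, u.2) : Term n m) u := ⟨u.1, by simp [Term.mul]⟩
  have hne : ∃ g ∈ st.G, ∃ w, IsSig τ g w ∧ Term.Dvd w u := by
    rcases h.basis u.2 with hP | hs | ⟨g, hg, hs⟩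
    · exact absurd (hu _ hP _ (isSig_basisVec u.2))
        (ModuleTermOrder.not_lt_of_le (ModuleTermOrder.le_of_dvd hdvd))
    · exact absurd (hs.of_dvd hdvd) hsyz
    · exact ⟨g, hg, _, hs, hdvd⟩
  have hpair : ∀ {a : FreeMod n m K} {w : Term n m}, IsSig τ a w →
      IsSigPolyPair τ F (w, bar F a) := fun hw => ⟨_, hw, rfl⟩
  obtain ⟨r, ⟨hr, w, hw, hwu⟩, hmax⟩ := exists_greatest_of_finite
    (s := {g | g ∈ st.G ∧ ∃ w, IsSig τ g w ∧ Term.Dvd w u})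
    (h.finite_G.subset fun _ hx => hx.1) hne
    (fun a b => ∀ v w, IsSig τ a v → IsSig τ b w → rwo (v, bar F a) (w, bar F b))
    (by
      rintro a - b ⟨-, x, hx, -⟩ c - hab hbc v w hv hw
      exact hrw.trans _ _ _ (hpair hv) (hpair hx) (hpair hw) (hab v x hv hx) (hbc x w hx hw))
    (by
      rintro a ⟨-, x, hx, -⟩ b ⟨-, y, hy, -⟩
      refine (hrw.total _ _ (hpair hx) (hpair hy)).imp (fun hxy v w hv hw => ?_)
        fun hxy v w hv hw => ?_
      · rwa [hv.unique hx, hw.unique hy]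
      · rwa [hv.unique hy, hw.unique hx])
  exact ⟨r, hr, w, hw, hwu, fun g hg v hv hvu => hmax g ⟨hg, v, hv, hvu⟩ v w hv hw⟩

/-- Below all pending signatures, the basis is a rewrite basis and a signature Gröbner basis. If a
multiple `t r` of a canonical rewriter were regular top reducible, one could choose the reducer
with the smallest possible signature; it would be a multiple of a canonical rewriter `d`, and the
S-pair of `r` and `d` could not be settled. -/
lemma isRewriteBasisIn_and_isSigGBIn (h : Invariant τ F rwo st) (hrw : IsRewriteOrder τ F rwo)
    (u : Term n m) (hu : BelowPending τ F st.P u) :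
    IsRewriteBasisIn τ F rwo st.G u ∧ IsSigGBIn τ F st.G u := by
  induction u using τ.wellFounded_lt.induction with
  | _ u ih =>
  have hbelow : ∀ v, τ.lt v u → BelowPending τ F st.P v := fun v hv p hp w hw =>
    ModuleTermOrder.lt_trans hv (hu p hp w hw)
  have hGB : IsSigGBUpTo τ F st.G u := fun v hv => (ih v hv (hbelow v hv)).2
  suffices hmain : IsRewriteBasisIn τ F rwo st.G u by
    refine ⟨hmain, ?_⟩
    rcases hmain with hs | ⟨r, w, t, hr, hw, hut, hirr⟩
    · exact isSigGBIn_of_isSyzSig hGB hs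
    · exact isSigGBIn_of_not_hasReducer hGB hr.1 (h.bar_ne_zero r hr.1) hw hut hirr
  by_cases hsyz : IsSyzSig τ F u
  · exact .inl hsyz
  obtain ⟨r, hcan⟩ := h.exists_isCanonRewriter hrw hu hsyz
  obtain ⟨hr, w, hw, ⟨t, hut⟩, -⟩ := id hcan
  refine .inr ⟨r, w, t, hcan, hw, hut, fun hred => ?_⟩
  -- Among all elements with the leading power-product of `t r`, choose one of minimal signature.
  obtain ⟨v, ⟨e, hev, he0, hdeg⟩, hmin⟩ := τ.wellFounded_lt.has_min
    {v | ∃ e, IsSig τ e v ∧ bar F e ≠ 0 ∧ mo.degree (bar F e) = t + mo.degree (bar F r)}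
    (by
      obtain ⟨g, hg, s, x, hx, hg0, hs, -⟩ := hred
      obtain ⟨h₁, h₂⟩ := degree_bar_monomial_smul (mo := mo) s (one_ne_zero (α := K)) hg0
      exact ⟨_, _, hx.monomial_smul s one_ne_zero, h₂, h₁.trans hs⟩)
  have hmin' : ∀ {x e'}, IsSig τ e' x → bar F e' ≠ 0 →
      mo.degree (bar F e') = t + mo.degree (bar F r) → τ.le v x := fun h₁ h₂ h₃ =>
    ModuleTermOrder.le_of_not_lt (hmin _ ⟨_, h₁, h₂, h₃⟩)
  have hred_le : ∀ {x : Term n m},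
      HasReducer τ F st.G x (t + mo.degree (bar F r)) → τ.lt v x := by
    rintro x ⟨g, hg, s, y, hy, hg0, hs, hlt⟩
    obtain ⟨h₁, h₂⟩ := degree_bar_monomial_smul (mo := mo) s (one_ne_zero (α := K)) hg0
    exact ModuleTermOrder.lt_of_le_of_lt
      (hmin' (hy.monomial_smul s one_ne_zero) h₂ (h₁.trans hs)) hlt
  have hvu : τ.lt v u := hred_le hred
  have hvsyz : ¬ IsSyzSig τ F v := by
    rintro ⟨s, hs0, hs⟩
    obtain ⟨c, -, hlt⟩ := hev.exists_sub_sigLT hs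
    have hbar : bar F (e - MvPolynomial.monomial (0 : PP n) c • s) = bar F e := by
      rw [bar_sub, bar_smul, hs0, mul_zero, sub_zero]
    obtain ⟨x, hx⟩ := exists_isSig τ (ne_zero_of_bar_ne_zero (hbar ▸ he0))
    exact ModuleTermOrder.not_lt_of_le (hmin' hx (hbar ▸ he0) (by rw [hbar, hdeg]))
      (hlt.lt_of_isSig hx)
  obtain ⟨d, y, s, hdcan, hy, hvs, hdirr⟩ := (ih v hvu (hbelow v hvu)).1.resolve_left hvsyz
  have hd := hdcan.1
  have hd0 := h.bar_ne_zero d hd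
  have hGBv : IsSigGBUpTo τ F st.G v := fun x hx => hGB x (ModuleTermOrder.lt_trans hx hvu)
  have hdeg' : t + mo.degree (bar F r) = s + mo.degree (bar F d) := by
    obtain ⟨h₁, h₂⟩ := degree_bar_monomial_smul (mo := mo) s (one_ne_zero (α := K)) hd0
    have hsig := hy.monomial_smul s (one_ne_zero (α := K))
    rw [← hvs] at hsig
    rw [← hdeg, ← h₁]
    refine mo.toSyn.injective (le_antisymm (hGBv.degree_le hev he0 (fun hh => ?_) hsig).2
      (hGBv.degree_le hsig h₂ (by rwa [h₁]) hev).2)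
    rw [hdeg] at hh
    exact ModuleTermOrder.lt_irrefl _ (hred_le hh)
  obtain ⟨q, rfl, rfl⟩ := exists_eq_add_cofactor hdeg'
  set ur := Term.mul (cofactor mo (bar F r) (bar F d)) w with hur
  set ud := Term.mul (cofactor mo (bar F d) (bar F r)) y with hud
  have hTr : IsSPairTerm τ F r d ur := ⟨w, hw, rfl⟩
  have hTd : IsSPairTerm τ F d r ud := ⟨y, hy, rfl⟩
  rw [Term.mul_add, ← hur] at hut
  rw [Term.mul_add, ← hud] at hvs
  have hlt : τ.lt ud ur := by
    rw [hut, hvs] at hvu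
    exact (ModuleTermOrder.mul_lt_mul_iff q).1 hvu
  have hr0 := h.bar_ne_zero r hr
  have hreg : IsRegularSPair τ F r d := ⟨hr0, hd0, ur, ud, hTr, hTd, hlt.2.symm⟩
  have hsig := isSig_spair hr0 hTr hTd hlt
  have hdvd : Term.Dvd ur u := ⟨q, hut⟩
  have hle : τ.le ur u := ModuleTermOrder.le_of_dvd hdvd
  have hcan' : IsCanonRewriter τ F rwo st.G ur r := hcan.of_dvd hdvd hw ⟨_, rfl⟩
  rcases h.settled r hr d hd hreg with hP | hP | ⟨x, hx, hx'⟩ | ⟨x, hx, hx'⟩ | ⟨x, hx, g, hg, hx'⟩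
  · exact ModuleTermOrder.not_lt_of_le hle (hu _ hP _ hsig)
  · refine ModuleTermOrder.not_lt_of_le hle (hu _ hP _ ?_)
    rw [Pair.toMod, spair_swap]
    exact hsig.neg
  · obtain rfl := hx.unique hTr
    exact hx'.elim (fun h' => hsyz (h'.of_dvd hdvd)) (fun h' => h' hcan')
  · obtain rfl := hx.unique hTd
    have hdvd' : Term.Dvd ud v := ⟨q, hvs⟩
    exact hx'.elim (fun h' => hvsyz (h'.of_dvd hdvd'))
      (fun h' => h' (hdcan.of_dvd hdvd' hy ⟨_, rfl⟩))
  · obtain rfl := hx.unique hsig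
    exact h.not_isSig_of_isCanonRewriter hrw hr hd hTr hTd hlt hcan'
      (fun z hz => hGB z (ModuleTermOrder.lt_of_lt_of_le hz hle)) hg hx'

end Invariant

/-! ### Syzygies of regular sequences -/

lemma exists_bar_eq_of_mem_span {i : Fin m} {q : MvPolynomial (Fin n) K}
    (hq : q ∈ Ideal.span (F '' {j | j < i})) :
    ∃ a : FreeMod n m K, bar F a = q ∧ ∀ j, ¬ j < i → a j = 0 := by
  induction hq using Submodule.span_induction with
  | mem x hx =>
    obtain ⟨j, hj, rfl⟩ := hx
    refine ⟨basisVec n K j, bar_basisVec j, fun k hk => ?_⟩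
    have : k ≠ j := fun h => hk (h ▸ hj)
    simp [basisVec, this]
  | zero => exact ⟨0, by simp, fun _ _ => rfl⟩
  | add x y _ _ hx hy =>
    obtain ⟨a, rfl, ha⟩ := hx
    obtain ⟨b, rfl, hb⟩ := hy
    exact ⟨a + b, by simp [bar, add_mul, Finset.sum_add_distrib],
      fun k hk => by simp [ha k hk, hb k hk]⟩
  | smul c x _ hx =>
    obtain ⟨a, rfl, ha⟩ := hx
    exact ⟨c • a, by rw [bar_smul, smul_eq_mul], fun k hk => by simp [ha k hk]⟩

lemma ModuleTermOrder.IsPot.lt_iff (hpot : τ.IsPot) (i : Fin m) (u : Term n m) :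
    τ.lt u (0, i) ↔ u.2 < i := by
  obtain ⟨s, j⟩ := u
  constructor
  · rintro ⟨hle, hne⟩
    refine ((hpot _ _ _ _).1 hle).resolve_right ?_
    rintro ⟨rfl, h⟩
    rw [map_zero, ← mo.eq_zero_iff, mo.toSyn_eq_zero_iff] at h
    exact hne (by rw [h])
  · intro h
    exact ⟨(hpot _ _ _ _).2 (.inl h), fun h' => h.ne (congrArg Prod.snd h')⟩

/-- The coefficient of the last component of a syzygy of a regular sequence lies in the ideal
generated by the preceding polynomials. -/
lemma mem_span_of_isSig {h : FreeMod n m K} {u : Term n m} (hreg : IsRegularSequence F)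
    (hpot : τ.IsPot) (h0 : bar F h = 0) (hu : IsSig τ h u) :
    h u.2 ∈ Ideal.span (F '' {j | j < u.2}) := by
  refine hreg _ _ ?_
  have hsum : h u.2 * F u.2 = -∑ j ∈ Finset.univ.erase u.2, h j * F j := by
    rw [eq_neg_iff_add_eq_zero, Finset.add_sum_erase _ (fun j => h j * F j) (Finset.mem_univ _)]
    exact h0
  rw [hsum]
  refine neg_mem (sum_mem fun j hj => ?_)
  rcases lt_or_gt_of_ne (Finset.ne_of_mem_erase hj) with hlt | hgt
  · exact Ideal.mul_mem_left _ _ (Ideal.subset_span ⟨j, hlt, rfl⟩)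
  · have : h j = 0 := by
      by_contra hne
      obtain ⟨s, hs⟩ := MvPolynomial.ne_zero_iff.1 hne
      rcases (hpot s u.1 j u.2).1 (hu.2 (s, j) (mem_termSupp.2 hs)) with h' | h'
      · exact absurd h' hgt.not_gt
      · exact hgt.ne' h'.1
    rw [this, zero_mul]
    exact zero_mem _

namespace Invariant

variable {st : State n m K}

lemma isSigGBUpTo (h : Invariant τ F rwo st) (hrw : IsRewriteOrder τ F rwo) {p : Pair n m K}
    (hp : IsSelectable τ F st.P p) {u : Term n m} (hu : IsSig τ (p.toMod mo F) u) :
    IsSigGBUpTo τ F st.G u := by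
  obtain ⟨-, u', hu', hmin⟩ := hp
  obtain rfl := hu.unique hu'
  exact fun v hv => (h.isRewriteBasisIn_and_isSigGBIn hrw v fun q hq w hw =>
    ModuleTermOrder.lt_of_lt_of_le hv (hmin q hq w hw)).2

/-- When `𝐞ᵢ` is selected, the basis is a Gröbner basis of the ideal of the preceding polynomials.
For a regular sequence, the signatures of the Koszul syzygies between `fᵢ` and the basis elements
thus divide all syzygy signatures in component `i`. -/
lemma exists_newSyzSigs_dvd (h : Invariant τ F rwo st) (hrw : IsRewriteOrder τ F rwo)
    (hreg : IsRegularSequence F) (hpot : τ.IsPot) {u : Term n m}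
    (hsel : IsSelectable τ F st.P (.basis u.2)) (hu : IsSyzSig τ F u) :
    ∃ s ∈ newSyzSigs τ F st.G (.basis u.2), Term.Dvd s u := by
  have hGB := h.isSigGBUpTo hrw hsel (isSig_basisVec u.2)
  obtain ⟨z, hz0, hz⟩ := hu
  obtain ⟨a, ha, ha0⟩ := exists_bar_eq_of_mem_span (mem_span_of_isSig hreg hpot hz0 hz)
  have hlt : SigLT τ a (0, u.2) := by
    intro v hv
    rw [hpot.lt_iff]
    by_contra hnot
    rw [mem_termSupp, ha0 _ hnot] at hv
    simp at hv
  have hcoeff := mem_termSupp.1 hz.1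
  have hne : bar F a ≠ 0 := by
    rw [ha]
    intro h'
    rw [h'] at hcoeff
    simp at hcoeff
  have hdeg : mo.degree (bar F a) = u.1 := by
    refine mo.toSyn.injective (le_antisymm ?_ ?_)
    · have := hz.2 (mo.degree (z u.2), u.2)
        (mem_termSupp.2 (mo.coeff_degree_ne_zero_iff.2 (ha ▸ hne)))
      rw [ha]
      exact (ModuleTermOrder.le_iff_of_eq _ _ _).1 this
    · rw [ha]
      exact mo.le_degree (MvPolynomial.mem_support_iff.2 hcoeff)
  obtain ⟨g, hg, t, w, hw, hg0, ht, hwlt⟩ := (hGB.sRedZero hlt).hasReducer hlt hne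
  rw [hdeg] at ht
  have hwi : w.2 < u.2 := (hpot.lt_iff _ (Term.mul t w)).1 hwlt
  refine ⟨(mo.degree (bar F g), u.2), ⟨g, hg, ?_⟩, t, by simp [Term.mul, ht]⟩
  -- The components of `g` from `u.2` on vanish.
  have hgj : ∀ j, ¬ j < u.2 → g j = 0 := by
    intro j hj
    by_contra hne'
    obtain ⟨s, hs⟩ := MvPolynomial.ne_zero_iff.1 hne'
    rcases (hpot s w.1 j w.2).1 (hw.2 (s, j) (mem_termSupp.2 hs)) with h' | h'
    · exact hj (h'.trans hwi)
    · exact hj (h'.1 ▸ hwi)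
  refine ⟨?_, ?_⟩
  · simp [mem_termSupp, hgj u.2 (lt_irrefl _), basisVec, mo.coeff_degree_ne_zero_iff.2 hg0]
  · rintro ⟨s, j⟩ hv
    rw [mem_termSupp] at hv
    rcases lt_trichotomy j u.2 with hj | rfl | hj
    · exact (hpot _ _ _ _).2 (.inl hj)
    · refine τ.compatible _ _ _ (mo.le_degree (MvPolynomial.mem_support_iff.2 ?_))
      simpa [hgj u.2 (lt_irrefl _), basisVec] using hv
    · simp [hgj j hj.not_gt, basisVec, hj.ne'] at hv

lemma exists_mem_union_newSyzSigs_dvd (h : Invariant τ F rwo st) (hrw : IsRewriteOrder τ F rwo)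
    (hreg : IsRegularSequence F) (hpot : τ.IsPot) {p : Pair n m K}
    (hsel : IsSelectable τ F st.P p) {u : Term n m} (hu : IsSyzSig τ F u)
    (hP : Pair.basis u.2 ∈ st.P → p = .basis u.2) :
    ∃ s ∈ st.S ∪ newSyzSigs τ F st.G p, Term.Dvd s u := by
  by_cases hmem : Pair.basis u.2 ∈ st.P
  · obtain rfl := hP hmem
    obtain ⟨s, hs, hsu⟩ := h.exists_newSyzSigs_dvd hrw hreg hpot hsel hu
    exact ⟨s, .inr hs, hsu⟩
  · obtain ⟨s, hs, hsu⟩ := h.exists_dvd u hu hmem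
    exact ⟨s, .inl hs, hsu⟩

/-- An element which passes the criterion does not have a syzygy signature. -/
lemma not_isSyzSig (h : Invariant τ F rwo st) (hrw : IsRewriteOrder τ F rwo)
    (hreg : IsRegularSequence F) (hpot : τ.IsPot) {p : Pair n m K}
    (hsel : IsSelectable τ F st.P p)
    (hcrit : ¬ SigCrit τ F rwo st.G (st.S ∪ newSyzSigs τ F st.G p) p) {u : Term n m}
    (hu : IsSig τ (p.toMod mo F) u) : ¬ IsSyzSig τ F u := by
  intro hsyz
  cases p with
  | basis i =>
    obtain rfl := hu.unique (isSig_basisVec i)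
    exact hcrit (h.exists_mem_union_newSyzSigs_dvd hrw hreg hpot hsel hsyz fun _ => rfl)
  | spair c d =>
    obtain ⟨hc, hd, hregular⟩ := h.spair_mem c d hsel.1
    obtain ⟨-, -, uc, ud, huc, hud, -⟩ := id hregular
    have hcomp : ∀ {a b : FreeMod n m K}, a ∈ st.G → IsSPairTerm τ F a b u →
        Pair.basis u.2 ∉ st.P := by
      rintro a b ha ⟨w, hw, rfl⟩
      exact h.basis_notMem a ha w hw
    rcases hregular.sig_eq_or hu huc hud with ⟨rfl, -⟩ | ⟨rfl, -⟩
    · exact hcrit (.inl ⟨u, huc, .inl (h.exists_mem_union_newSyzSigs_dvd hrw hreg hpot hsel hsyz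
        fun h' => absurd h' (hcomp hc huc))⟩)
    · exact hcrit (.inr ⟨u, hud, .inl (h.exists_mem_union_newSyzSigs_dvd hrw hreg hpot hsel hsyz
        fun h' => absurd h' (hcomp hd hud))⟩)

/-- There are no zero-reductions. -/
lemma bar_ne_zero_of_reachesZeroTest (h : Invariant τ F rwo st) (hrw : IsRewriteOrder τ F rwo)
    (hreg : IsRegularSequence F) (hpot : τ.IsPot) {p : Pair n m K} {b : FreeMod n m K}
    (htest : ReachesZeroTest τ F rwo st p b) : bar F b ≠ 0 := by
  obtain ⟨hsel, hcrit, hnf⟩ := htest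
  obtain ⟨u, hu⟩ := h.exists_isSig_toMod hsel.1
  exact fun h0 => h.not_isSyzSig hrw hreg hpot hsel hcrit hu ⟨b, h0, hnf.isSig hu⟩

/-! ### Preservation of the invariant -/

lemma isSyzSig_union (h : Invariant τ F rwo st) (p : Pair n m K) {s : Term n m}
    (hs : s ∈ st.S ∪ newSyzSigs τ F st.G p) : IsSyzSig τ F s := by
  rcases hs with hs | hs
  · exact h.isSyzSig s hs
  · cases p with
    | basis i =>
      obtain ⟨g, -, hg⟩ := hs
      exact ⟨_, by rw [bar_sub, bar_smul, bar_smul, bar_basisVec, mul_comm, sub_self], hg⟩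
    | spair a b => exact hs.elim

lemma isSettled_of_sigCrit (h : Invariant τ F rwo st) {a b : FreeMod n m K}
    (hcrit : SigCrit τ F rwo st.G (st.S ∪ newSyzSigs τ F st.G (.spair a b)) (.spair a b)) :
    IsSettled τ F rwo st.G a b := by
  rcases hcrit with ⟨w, hw, h'⟩ | ⟨w, hw, h'⟩
  · exact .inl ⟨w, hw, h'.imp_left fun ⟨s, hs, hd⟩ => (h.isSyzSig_union _ hs).of_dvd hd⟩
  · exact .inr (.inl ⟨w, hw, h'.imp_left fun ⟨s, hs, hd⟩ => (h.isSyzSig_union _ hs).of_dvd hd⟩)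

lemma discard (h : Invariant τ F rwo st) (hrw : IsRewriteOrder τ F rwo)
    (hreg : IsRegularSequence F) (hpot : τ.IsPot) {p : Pair n m K}
    (hsel : IsSelectable τ F st.P p)
    (hcrit : SigCrit τ F rwo st.G (st.S ∪ newSyzSigs τ F st.G p) p) :
    Invariant τ F rwo ⟨st.G, st.S ∪ newSyzSigs τ F st.G p, st.P \ {p}, st.z⟩ where
  finite_G := h.finite_G
  finite_P := h.finite_P.sdiff
  bar_ne_zero := h.bar_ne_zero
  irreducible := h.irreducible
  sig_le g hg w hw q hq := h.sig_le g hg w hw q hq.1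
  basis i := by
    by_cases hi : Pair.basis i = p
    · subst hi
      obtain ⟨s, hs, hd⟩ := hcrit
      exact .inr (.inl ((h.isSyzSig_union _ hs).of_dvd hd))
    · exact (h.basis i).imp_left fun h' => ⟨h', hi⟩
  spair_mem a b hab := h.spair_mem a b hab.1
  settled a ha b hb hr := by
    by_cases h₁ : Pair.spair a b = p
    · subst h₁
      exact .inr (.inr (h.isSettled_of_sigCrit hcrit))
    by_cases h₂ : Pair.spair b a = p
    · subst h₂
      exact .inr (.inr (h.isSettled_of_sigCrit hcrit).symm)
    exact (h.settled a ha b hb hr).imp (fun h' => ⟨h', h₁⟩) (Or.imp_left fun h' => ⟨h', h₂⟩)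
  isSyzSig s hs := h.isSyzSig_union p hs
  basis_notMem g hg w hw h' := h.basis_notMem g hg w hw h'.1
  exists_dvd u hu hP := h.exists_mem_union_newSyzSigs_dvd hrw hreg hpot hsel hu fun h' => by
    by_contra hne
    exact hP ⟨h', fun h'' => hne h''.symm⟩
  sig_injective := h.sig_injective
  origin := h.origin
  counter := h.counter

/-- The signature of a new basis element does not occur in the basis yet. -/
lemma not_isSig_of_mem (h : Invariant τ F rwo st) (hrw : IsRewriteOrder τ F rwo) {p : Pair n m K}
    (hsel : IsSelectable τ F st.P p)
    (hcrit : ¬ SigCrit τ F rwo st.G (st.S ∪ newSyzSigs τ F st.G p) p) {u : Term n m}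
    (hu : IsSig τ (p.toMod mo F) u) {g : FreeMod n m K} (hg : g ∈ st.G) : ¬ IsSig τ g u := by
  have hGB := h.isSigGBUpTo hrw hsel hu
  cases p with
  | basis i =>
    intro hgu
    obtain rfl := hu.unique (isSig_basisVec i)
    exact h.basis_notMem g hg _ hgu hsel.1
  | spair c d =>
    obtain ⟨hc, hd, hregular⟩ := h.spair_mem c d hsel.1
    obtain ⟨-, -, uc, ud, huc, hud, -⟩ := id hregular
    rcases hregular.sig_eq_or hu huc hud with ⟨rfl, hlt⟩ | ⟨rfl, hlt⟩
    · exact h.not_isSig_of_isCanonRewriter hrw hc hd huc hud hlt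
        (by_contra fun h' => hcrit (.inl ⟨u, huc, .inr h'⟩)) hGB hg
    · exact h.not_isSig_of_isCanonRewriter hrw hd hc hud huc hlt
        (by_contra fun h' => hcrit (.inr ⟨u, hud, .inr h'⟩)) hGB hg

end Invariant

/-- The leading power-products of the two components of an S-pair cancel. -/
lemma degree_bar_spair_lt {c d : FreeMod n m K} (hc : bar F c ≠ 0) (hd : bar F d ≠ 0)
    (h0 : bar F (spair mo F c d) ≠ 0) :
    mo.degree (bar F (spair mo F c d)) ≺[mo] mo.degree (bar F c) ⊔ mo.degree (bar F d) := by
  have hle : ∀ (p q : MvPolynomial (Fin n) K) (x : K),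
      mo.degree (MvPolynomial.monomial (cofactor mo p q) x * p) ≼[mo] mo.degree p ⊔ mo.degree q :=
    fun p q x => cofactor_add_degree (mo := mo) p q ▸ degree_monomial_mul_le _ _ _
  have hcoeff : ∀ {p : MvPolynomial (Fin n) K}, p ≠ 0 → ∀ q,
      (MvPolynomial.monomial (cofactor mo p q) (mo.leadingCoeff p)⁻¹ * p).coeff
        (mo.degree p ⊔ mo.degree q) = 1 := by
    intro p hp q
    rw [← cofactor_add_degree, MvPolynomial.coeff_monomial_mul, ← MonomialOrder.leadingCoeff,
      inv_mul_cancel₀ (mo.leadingCoeff_ne_zero_iff.2 hp)]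
  have hbar : bar F (spair mo F c d) =
      MvPolynomial.monomial (cofactor mo (bar F c) (bar F d)) (mo.leadingCoeff (bar F c))⁻¹ *
        bar F c -
      MvPolynomial.monomial (cofactor mo (bar F d) (bar F c)) (mo.leadingCoeff (bar F d))⁻¹ *
        bar F d := by
    rw [spair, bar_sub, bar_smul, bar_smul]
  refine lt_of_le_of_ne ?_ fun heq => ?_
  · rw [hbar]
    refine mo.degree_sub_le.trans (sup_le (hle _ _ _) ?_)
    rw [sup_comm]
    exact hle _ _ _
  · have := mo.coeff_degree_ne_zero_iff.2 h0
    rw [mo.toSyn.injective heq, hbar, MvPolynomial.coeff_sub, hcoeff hc, sup_comm, hcoeff hd,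
      sub_self] at this
    exact this rfl

lemma ratioLT_of_lt {b c : FreeMod n m K} {u w : Term n m} {t : PP n} (hb : IsSig τ b u)
    (hc : IsSig τ c w) (hle : τ.le (Term.mul t w) u)
    (hlt : mo.degree (bar F b) ≺[mo] t + mo.degree (bar F c)) : RatioLT τ F c b := by
  refine ⟨w, u, hc, hb, (ModuleTermOrder.mul_lt_mul_iff t).1 ?_⟩
  rw [Term.mul_comm, ← Term.mul_add t]
  exact ModuleTermOrder.lt_of_le_of_lt (τ.mul_mono _ _ _ hle)
    (ModuleTermOrder.mul_lt_mul_right hlt u)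

namespace Invariant

variable {st : State n m K}

lemma origin_of_reachesZeroTest (h : Invariant τ F rwo st) (hrw : IsRewriteOrder τ F rwo)
    {p : Pair n m K} {b : FreeMod n m K} (htest : ReachesZeroTest τ F rwo st p b)
    (hb0 : bar F b ≠ 0) :
    (∃ i, IsSig τ b (0, i)) ∨ ∃ c ∈ st.G, ∃ d ∈ st.G,
      RatioLT τ F c b ∧ RatioLT τ F d b ∧ ∃ w, IsSPairTerm τ F c d w ∧ IsSig τ b w := by
  obtain ⟨hsel, hcrit, hnf⟩ := htest
  cases p with
  | basis i => exact .inl ⟨i, hnf.isSig (isSig_basisVec i)⟩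
  | spair c d =>
    right
    obtain ⟨hc, hd, hregular⟩ := h.spair_mem c d hsel.1
    obtain ⟨u, hu⟩ := hregular.exists_isSig
    have hb := hnf.isSig hu
    obtain ⟨hc0, hd0, uc, ud, huc, hud, -⟩ := id hregular
    have hne : bar F (spair mo F c d) ≠ 0 := fun h0 =>
      (h.isSigGBUpTo hrw hsel hu).not_isSyzSig hb hb0 (hnf.not_hasReducer hu hb0) ⟨_, h0, hu⟩
    have hlt : mo.degree (bar F b) ≺[mo] mo.degree (bar F c) ⊔ mo.degree (bar F d) :=
      hnf.degree_le.trans_lt (degree_bar_spair_lt hc0 hd0 hne)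
    have hlt' := hlt
    rw [← cofactor_add_degree] at hlt
    rw [sup_comm, ← cofactor_add_degree] at hlt'
    rcases hregular.sig_eq_or hu huc hud with ⟨rfl, hltu⟩ | ⟨rfl, hltu⟩ <;>
    obtain ⟨x, hx, rfl⟩ := id huc <;> obtain ⟨y, hy, rfl⟩ := id hud
    · exact ⟨c, hc, d, hd, ratioLT_of_lt hb hx (τ.refl _) hlt, ratioLT_of_lt hb hy hltu.1 hlt',
        _, huc, hb⟩
    · exact ⟨d, hd, c, hc, ratioLT_of_lt hb hy (τ.refl _) hlt', ratioLT_of_lt hb hx hltu.1 hlt,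
        _, hud, hb⟩

lemma addToBasis (h : Invariant τ F rwo st) (hrw : IsRewriteOrder τ F rwo)
    (hreg : IsRegularSequence F) (hpot : τ.IsPot) {p : Pair n m K} {b : FreeMod n m K}
    (htest : ReachesZeroTest τ F rwo st p b) (hb0 : bar F b ≠ 0) :
    Invariant τ F rwo ⟨insert b st.G, st.S ∪ newSyzSigs τ F st.G p,
      (st.P \ {p}) ∪ {q | ∃ g ∈ st.G, IsRegularSPair τ F g b ∧ q = Pair.spair g b}, st.z⟩ := by
  have horigin := h.origin_of_reachesZeroTest hrw htest hb0
  obtain ⟨hsel, hcrit, hnf⟩ := htest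
  obtain ⟨u, hu⟩ := h.exists_isSig_toMod hsel.1
  have hmin : ∀ q ∈ st.P, ∀ v, IsSig τ (q.toMod mo F) v → τ.le u v := by
    obtain ⟨-, u', hu', hmin⟩ := hsel
    obtain rfl := hu.unique hu'
    exact hmin
  have hb := hnf.isSig hu
  have hirr := hnf.not_hasReducer hu hb0
  have hfresh : ∀ g ∈ st.G, ¬ IsSig τ g u := fun g hg => h.not_isSig_of_mem hrw hsel hcrit hu hg
  have hle : ∀ g ∈ st.G, ∀ w, IsSig τ g w → τ.le w u := fun g hg w hw =>
    h.sig_le g hg w hw p hsel.1 u hu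
  have hle' : ∀ g ∈ insert b st.G, ∀ w, IsSig τ g w → τ.le w u := by
    rintro g (rfl | hg) w hw
    · rw [hw.unique hb]
      exact τ.refl _
    · exact hle g hg w hw
  -- `b` is not a reducer for elements whose signature does not exceed its own.
  have hred : ∀ {w : Term n m} {v : PP n}, τ.le w u → HasReducer τ F (insert b st.G) w v →
      HasReducer τ F st.G w v := by
    rintro w v hwu ⟨g, rfl | hg, t, x, hx, hg0, ht, hlt⟩
    · rw [hx.unique hb] at hlt
      exact absurd hlt
        (ModuleTermOrder.not_lt_of_le (τ.trans _ _ _ hwu (ModuleTermOrder.le_mul t u)))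
    · exact ⟨g, hg, t, x, hx, hg0, ht, hlt⟩
  have hsub : st.G ⊆ insert b st.G := Set.subset_insert _ _
  exact
    { finite_G := h.finite_G.insert b
      finite_P := h.finite_P.sdiff.union <| (h.finite_G.image fun g => Pair.spair g b).subset <| by
        rintro q ⟨g, hg, -, rfl⟩
        exact ⟨g, hg, rfl⟩
      bar_ne_zero := by
        rintro g (rfl | hg)
        · exact hb0
        · exact h.bar_ne_zero g hg
      irreducible := by
        rintro g (rfl | hg) w hw hr
        · obtain rfl := hw.unique hb
          exact hirr (hred (τ.refl _) hr)
        · exact h.irreducible g hg w hw (hred (hle g hg w hw) hr)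
      sig_le := by
        rintro g hg w hw q hq v hv
        refine τ.trans _ _ _ (hle' g hg w hw) ?_
        rcases hq with hq | ⟨g', -, hr, rfl⟩
        · exact hmin q hq.1 v hv
        · obtain ⟨-, -, x, y, hx, hy, -⟩ := id hr
          have huy : τ.le u y := by
            rw [hy.eq hb]
            exact ModuleTermOrder.le_mul _ _
          rcases hr.sig_eq_or hv hx hy with ⟨rfl, hlt⟩ | ⟨rfl, -⟩
          · exact τ.trans _ _ _ huy hlt.1
          · exact huy
      basis := by
        intro i
        by_cases hi : Pair.basis i = p
        · subst hi
          refine .inr (.inr ⟨b, .inl rfl, ?_⟩)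
          rwa [← hu.unique (isSig_basisVec i)]
        · exact (h.basis i).imp (fun h' => .inl ⟨h', hi⟩)
            (Or.imp_right fun ⟨g, hg, hg'⟩ => ⟨g, hsub hg, hg'⟩)
      spair_mem := by
        rintro c d (hcd | ⟨g, hg, hr, heq⟩)
        · obtain ⟨hc, hd, hr⟩ := h.spair_mem c d hcd.1
          exact ⟨hsub hc, hsub hd, hr⟩
        · cases heq
          exact ⟨hsub hg, .inl rfl, hr⟩
      settled := by
        have hnew : ∀ c d, Pair.spair c d ∈ st.P →
            Pair.spair c d ∈ (st.P \ {p}) ∪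
              {q | ∃ g ∈ st.G, IsRegularSPair τ F g b ∧ q = Pair.spair g b} ∨
            IsSettled τ F rwo (insert b st.G) c d := by
          intro c d hcd
          by_cases heq : Pair.spair c d = p
          · subst heq
            exact .inr (.inr (.inr ⟨u, hu, b, .inl rfl, hb⟩))
          · exact .inl (.inl ⟨hcd, heq⟩)
        rintro c (rfl | hc) d (rfl | hd) hr
        · exact absurd hr (not_isRegularSPair_self _)
        · exact .inr (.inl (.inr ⟨d, hd, hr.symm, rfl⟩))
        · exact .inl (.inr ⟨c, hc, hr, rfl⟩)
        · rcases h.settled c hc d hd hr with h' | h' | h'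
          · exact (hnew c d h').imp_right .inr
          · exact .inr ((hnew d c h').imp_right IsSettled.symm)
          · exact .inr (.inr (h'.mono hsub hc hd))
      isSyzSig := fun s hs => h.isSyzSig_union p hs
      basis_notMem := by
        rintro g hg w hw (⟨hP, hne⟩ | ⟨_, _, _, heq⟩)
        · rcases hg with rfl | hg
          · obtain rfl := hw.unique hb
            cases p with
            | basis i => exact hne (by rw [hu.unique (isSig_basisVec i)]; rfl)
            | spair c d =>
              obtain ⟨hc, hd, hr⟩ := h.spair_mem c d hsel.1
              obtain ⟨-, -, x, y, hx, hy, -⟩ := id hr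
              rcases hr.sig_eq_or hu hx hy with ⟨rfl, -⟩ | ⟨rfl, -⟩
              · obtain ⟨v, hv, rfl⟩ := hx
                exact h.basis_notMem c hc v hv hP
              · obtain ⟨v, hv, rfl⟩ := hy
                exact h.basis_notMem d hd v hv hP
          · exact h.basis_notMem g hg w hw hP
        · cases heq
      exists_dvd := fun v hv hP =>
        h.exists_mem_union_newSyzSigs_dvd hrw hreg hpot hsel hv fun h' => by
          by_contra hne
          exact hP (.inl ⟨h', fun h'' => hne h''.symm⟩)
      sig_injective := by
        rintro g (rfl | hg) g' (rfl | hg') w hw hw'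
        · rfl
        · obtain rfl := hw.unique hb
          exact absurd hw' (hfresh g' hg')
        · obtain rfl := hw'.unique hb
          exact absurd hw (hfresh g hg)
        · exact h.sig_injective g hg g' hg' w hw hw'
      origin := by
        have hlift : ∀ g, ((∃ i, IsSig τ g (0, i)) ∨ ∃ c ∈ st.G, ∃ d ∈ st.G,
            RatioLT τ F c g ∧ RatioLT τ F d g ∧ ∃ w, IsSPairTerm τ F c d w ∧ IsSig τ g w) →
            (∃ i, IsSig τ g (0, i)) ∨ ∃ c ∈ insert b st.G, ∃ d ∈ insert b st.G,
            RatioLT τ F c g ∧ RatioLT τ F d g ∧ ∃ w, IsSPairTerm τ F c d w ∧ IsSig τ g w :=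
          fun g => Or.imp_right fun ⟨c, hc, d, hd, h'⟩ => ⟨c, hsub hc, d, hsub hd, h'⟩
        rintro g (rfl | hg)
        · exact hlift _ horigin
        · exact hlift g (h.origin g hg)
      counter := h.counter }

lemma step (h : Invariant τ F rwo st) (hrw : IsRewriteOrder τ F rwo)
    (hreg : IsRegularSequence F) (hpot : τ.IsPot) {st' : State n m K}
    (hstep : Step τ F rwo st st') : Invariant τ F rwo st' := by
  cases hstep with
  | discard p hsel hcrit => exact h.discard hrw hreg hpot hsel hcrit
  | zeroReduction p b htest h0 =>
    exact absurd h0 (h.bar_ne_zero_of_reachesZeroTest hrw hreg hpot htest)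
  | addToBasis p b htest h0 => exact h.addToBasis hrw hreg hpot htest h0

end Invariant

lemma invariant_initState : Invariant τ F rwo (initState τ F) where
  finite_G := Set.finite_empty
  finite_P := Set.finite_range _
  bar_ne_zero _ hg := hg.elim
  irreducible _ hg := hg.elim
  sig_le _ hg := hg.elim
  basis i := .inl ⟨i, rfl⟩
  spair_mem a b h := by
    obtain ⟨i, hi⟩ := h
    cases hi
  settled _ ha := ha.elim
  isSyzSig := by
    rintro s ⟨i, j, -, hs⟩
    exact ⟨_, by rw [bar_sub, bar_smul, bar_smul, bar_basisVec, bar_basisVec, mul_comm, sub_self],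
      hs⟩
  basis_notMem _ hg := hg.elim
  exists_dvd u _ h := (h ⟨u.2, rfl⟩).elim
  sig_injective _ hg := hg.elim
  origin _ hg := hg.elim
  counter := rfl

lemma Reachable.invariant (hrw : IsRewriteOrder τ F rwo) (hreg : IsRegularSequence F)
    (hpot : τ.IsPot) {st : State n m K} (h : Reachable τ F rwo st) : Invariant τ F rwo st := by
  induction h with
  | refl => exact invariant_initState
  | tail _ hstep ih => exact ih.step hrw hreg hpot hstep

/-! ### Ratios of signature and leading power-product -/

lemma ratioLT_iff {a b : FreeMod n m K} {u v : Term n m} (ha : IsSig τ a u) (hb : IsSig τ b v) :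
    RatioLT τ F a b ↔
      τ.lt (Term.mul (mo.degree (bar F b)) u) (Term.mul (mo.degree (bar F a)) v) := by
  constructor
  · rintro ⟨u', v', hu', hv', h⟩
    rwa [ha.unique hu', hb.unique hv']
  · exact fun h => ⟨u, v, ha, hb, h⟩

/-- Ratios are totally preordered: if `a` is at most `b`, and `b` is less than `c`, then `a` is less
than `c`. -/
lemma RatioLT.of_not_ratioLT {a b c : FreeMod n m K} (h : RatioLT τ F b c)
    (ha : ∃ u, IsSig τ a u) (hab : ¬ RatioLT τ F b a) : RatioLT τ F a c := by
  obtain ⟨x, hx⟩ := ha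
  obtain ⟨y, z, hy, hz, h⟩ := h
  rw [ratioLT_iff hy hx] at hab
  rw [ratioLT_iff hx hz, ← ModuleTermOrder.mul_lt_mul_iff (mo.degree (bar F b)), Term.mul_comm,
    Term.mul_comm _ _ z]
  refine ModuleTermOrder.lt_of_le_of_lt
    (τ.mul_mono _ _ _ (ModuleTermOrder.le_of_not_lt hab)) ?_
  rw [Term.mul_comm]
  exact (ModuleTermOrder.mul_lt_mul_iff _).2 h

lemma RatioLT.asymm {a b : FreeMod n m K} (h : RatioLT τ F a b) : ¬ RatioLT τ F b a := by
  obtain ⟨u, v, hu, hv, h⟩ := h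
  rw [ratioLT_iff hv hu]
  exact ModuleTermOrder.not_lt_of_le h.1

/-- In a well-quasi-order, every set lies above a finite subset. -/
lemma exists_finite_subset_le {α : Type*} [PartialOrder α] [WellQuasiOrderedLE α] (s : Set α) :
    ∃ t ⊆ s, t.Finite ∧ ∀ x ∈ s, ∃ y ∈ t, y ≤ x := by
  refine ⟨{x | Minimal (· ∈ s) x}, fun x hx => hx.prop,
    WellQuasiOrderedLE.finite_of_isAntichain (setOfPred_minimal_antichain _), fun x hx => ?_⟩
  obtain ⟨y, hyx, hy⟩ := exists_minimal_le_of_wellFoundedLT (· ∈ s) x hx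
  exact ⟨y, hy, hyx⟩

/-- Dickson's lemma for pairs of a signature and a leading power-product. -/
lemma exists_finite_dvd (X : Set (FreeMod n m K)) :
    ∃ R ⊆ X, R.Finite ∧ ∀ g ∈ X, ∀ w, IsSig τ g w →
      ∃ r ∈ R, ∃ u, IsSig τ r u ∧ Term.Dvd u w ∧
        mo.degree (bar F r) ≤ mo.degree (bar F g) := by
  have hcomp : ∀ i : Fin m, ∃ R ⊆ X, R.Finite ∧ ∀ g ∈ X, ∀ s, IsSig τ g (s, i) →
      ∃ r ∈ R, ∃ u, IsSig τ r u ∧ Term.Dvd u (s, i) ∧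
        mo.degree (bar F r) ≤ mo.degree (bar F g) := by
    intro i
    obtain ⟨M, hM, hfin, hle⟩ := exists_finite_subset_le
      {x : PP n × PP n | ∃ g ∈ X, IsSig τ g (x.1, i) ∧ mo.degree (bar F g) = x.2}
    choose f hfX hfsig hfdeg using fun x : M => hM x.2
    have := hfin.to_subtype
    refine ⟨Set.range f, Set.range_subset_iff.2 hfX, Set.finite_range f, fun g hg s hs => ?_⟩
    obtain ⟨y, hy, hyle⟩ := hle (s, mo.degree (bar F g)) ⟨g, hg, hs, rfl⟩
    refine ⟨f ⟨y, hy⟩, ⟨_, rfl⟩, _, hfsig ⟨y, hy⟩, ⟨s - y.1, ?_⟩, ?_⟩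
    · simp [Term.mul, tsub_add_cancel_of_le hyle.1]
    · rw [hfdeg]
      exact hyle.2
  choose R hRX hRfin hR using hcomp
  refine ⟨⋃ i, R i, Set.iUnion_subset hRX, Set.finite_iUnion hRfin, fun g hg w hw => ?_⟩
  obtain ⟨r, hr, h⟩ := hR w.2 g hg w.1 hw
  exact ⟨r, Set.mem_iUnion.2 ⟨_, hr⟩, h⟩

/-- If divisibility of signatures and leading power-products implies equality of ratios, then only
finitely many ratios occur, by Dickson's lemma. If, moreover, each element is determined by its
signature, and stems from a basis vector or from two elements with smaller ratio, then induction on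
the number of smaller ratios shows that there are only finitely many elements. -/
lemma finite_of_ratioLT {X : Set (FreeMod n m K)} (hsig : ∀ g ∈ X, ∃ w, IsSig τ g w)
    (hinj : ∀ g ∈ X, ∀ g' ∈ X, ∀ w, IsSig τ g w → IsSig τ g' w → g = g')
    (horigin : ∀ g ∈ X, (∃ i, IsSig τ g (0, i)) ∨ ∃ c ∈ X, ∃ d ∈ X,
      RatioLT τ F c g ∧ RatioLT τ F d g ∧ ∃ w, IsSPairTerm τ F c d w ∧ IsSig τ g w)
    (hratio : ∀ g ∈ X, ∀ g' ∈ X, ∀ w w', IsSig τ g w → IsSig τ g' w' → Term.Dvd w w' →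
      mo.degree (bar F g) ≤ mo.degree (bar F g') → ¬ RatioLT τ F g g' ∧ ¬ RatioLT τ F g' g) :
    X.Finite := by
  rcases X.eq_empty_or_nonempty with rfl | ⟨x, hx⟩
  · exact Set.finite_empty
  have : Nonempty (Term n m) := ⟨(hsig x hx).choose⟩
  obtain ⟨R, hRX, hRfin, hR⟩ := exists_finite_dvd (τ := τ) (F := F) X
  set rank : FreeMod n m K → ℕ := fun g => {r ∈ R | RatioLT τ F r g}.ncard with hrank
  have hlt : ∀ c ∈ X, ∀ g, RatioLT τ F c g → rank c < rank g := by
    intro c hc g hcg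
    refine Set.ncard_lt_ncard ?_ (hRfin.subset fun _ h => h.1)
    refine (Set.ssubset_iff_of_subset ?_).2 ?_
    · rintro r ⟨hr, hrc⟩
      exact ⟨hr, hcg.of_not_ratioLT (hsig r (hRX hr)) hrc.asymm⟩
    · obtain ⟨w, hw⟩ := hsig c hc
      obtain ⟨r, hr, u, hu, huw, hdeg⟩ := hR c hc w hw
      obtain ⟨h₁, h₂⟩ := hratio r (hRX hr) c hc u w hu hw huw hdeg
      exact ⟨r, ⟨hr, hcg.of_not_ratioLT ⟨u, hu⟩ h₂⟩, fun h => h₁ h.2⟩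
  have hfin : ∀ k, {g ∈ X | rank g < k}.Finite := by
    intro k
    induction k with
    | zero => simp
    | succ k ih =>
      set A := {g ∈ X | rank g < k} with hA
      have hterms : (Set.range (fun i : Fin m => ((0, i) : Term n m)) ∪
          ⋃ c ∈ A, ⋃ d ∈ A, {w | IsSPairTerm τ F c d w}).Finite :=
        (Set.finite_range _).union <| ih.biUnion fun c _ => ih.biUnion fun d _ =>
          Set.Subsingleton.finite fun _ hx _ hy => hx.unique hy
      choose! sig hs using hsig
      refine Set.Finite.of_finite_image (f := sig) (hterms.subset ?_) ?_
      · rintro _ ⟨g, ⟨hg, hgk⟩, rfl⟩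
        rcases horigin g hg with ⟨i, hi⟩ | ⟨c, hc, d, hd, hcg, hdg, w, hw, hgw⟩
        · exact .inl ⟨i, hi.unique (hs g hg)⟩
        · rw [(hs g hg).unique hgw]
          refine .inr (Set.mem_biUnion (x := c) ⟨hc, ?_⟩ (Set.mem_biUnion (x := d) ⟨hd, ?_⟩ hw))
          · exact (hlt c hc g hcg).trans_le (Nat.le_of_lt_succ hgk)
          · exact (hlt d hd g hdg).trans_le (Nat.le_of_lt_succ hgk)
      · rintro g ⟨hg, -⟩ g' ⟨hg', -⟩ heq
        exact hinj g hg g' hg' _ (hs g hg) (heq ▸ hs g' hg')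
  refine (hfin (R.ncard + 1)).subset fun g hg => ⟨hg, Nat.lt_succ_of_le ?_⟩
  exact Set.ncard_le_ncard (fun _ h => h.1) hRfin

/-! ### Termination -/

namespace Invariant

variable {st : State n m K}

lemma isSigGBUpTo_of_mem (h : Invariant τ F rwo st) (hrw : IsRewriteOrder τ F rwo)
    {g : FreeMod n m K} (hg : g ∈ st.G) {w : Term n m} (hw : IsSig τ g w) :
    IsSigGBUpTo τ F st.G w := fun v hv =>
  (h.isRewriteBasisIn_and_isSigGBIn hrw v fun p hp x hx =>
    ModuleTermOrder.lt_of_lt_of_le hv (h.sig_le g hg w hw p hp x hx)).2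

/-- If `g` divides `g'` in signature and leading power-product, then both have the same ratio:
otherwise `g'` would be regular top reducible by `g`, or a multiple of `g` would have the signature
of `g'` and a smaller leading power-product. -/
lemma not_ratioLT (h : Invariant τ F rwo st) (hrw : IsRewriteOrder τ F rwo)
    {g g' : FreeMod n m K} (hg : g ∈ st.G) (hg' : g' ∈ st.G) {w w' : Term n m}
    (hw : IsSig τ g w) (hw' : IsSig τ g' w') (hdvd : Term.Dvd w w')
    (hdeg : mo.degree (bar F g) ≤ mo.degree (bar F g')) :
    ¬ RatioLT τ F g g' ∧ ¬ RatioLT τ F g' g := by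
  obtain ⟨t, rfl⟩ := hdvd
  obtain ⟨s, hs⟩ := exists_add_of_le hdeg
  rw [ratioLT_iff hw hw', ratioLT_iff hw' hw, hs, Term.mul_add, ModuleTermOrder.mul_lt_mul_iff,
    ModuleTermOrder.mul_lt_mul_iff]
  have hg0 := h.bar_ne_zero g hg
  have hirr := h.irreducible g' hg' _ hw'
  refine ⟨fun hlt => hirr ⟨g, hg, s, w, hw, hg0, by rw [hs, add_comm], hlt⟩, ?_⟩
  obtain ⟨h₁, -⟩ := degree_bar_monomial_smul (mo := mo) t (one_ne_zero (α := K)) hg0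
  have hle := ((h.isSigGBUpTo_of_mem hrw hg' hw').degree_le hw' (h.bar_ne_zero g' hg') hirr
    (hw.monomial_smul t one_ne_zero)).2
  rw [h₁, hs, add_comm, map_add, map_add, add_le_add_iff_right] at hle
  exact ModuleTermOrder.not_lt_of_le (ModuleTermOrder.mul_le_mul_right hle w)

/-- An execution does not get stuck inside the main loop. -/
lemma exists_step (h : Invariant τ F rwo st) (hP : st.P ≠ ∅) : ∃ st', Step τ F rwo st st' := by
  obtain ⟨q, hq⟩ := Set.nonempty_iff_ne_empty.2 hP
  obtain ⟨v, hv⟩ := h.exists_isSig_toMod hq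
  obtain ⟨u, ⟨p, hp, hu⟩, hmin⟩ := τ.wellFounded_lt.has_min
    {u | ∃ p ∈ st.P, IsSig τ (p.toMod mo F) u} ⟨v, q, hq, hv⟩
  have hsel : IsSelectable τ F st.P p :=
    ⟨hp, u, hu, fun q hq v hv => ModuleTermOrder.le_of_not_lt (hmin v ⟨q, hq, hv⟩)⟩
  by_cases hcrit : SigCrit τ F rwo st.G (st.S ∪ newSyzSigs τ F st.G p) p
  · exact ⟨_, .discard st p hsel hcrit⟩
  obtain ⟨b, hb⟩ := exists_isRegNormalForm (F := F) st.G hu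
  by_cases hb0 : bar F b = 0
  · exact ⟨_, .zeroReduction st p b ⟨hsel, hcrit, hb⟩ hb0⟩
  · exact ⟨_, .addToBasis st p b ⟨hsel, hcrit, hb⟩ hb0⟩

/-- A step either adds an element to the basis, or shrinks the set of pending elements. -/
lemma step_cases (h : Invariant τ F rwo st) (hrw : IsRewriteOrder τ F rwo)
    (hreg : IsRegularSequence F) (hpot : τ.IsPot) {st' : State n m K}
    (hstep : Step τ F rwo st st') :
    (∃ b ∉ st.G, st'.G = insert b st.G) ∨ (st'.G = st.G ∧ st'.P ⊂ st.P) := by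
  cases hstep with
  | discard p hsel hcrit =>
    exact .inr ⟨rfl, Set.sdiff_subset, fun hsub => (hsub hsel.1).2 rfl⟩
  | zeroReduction p b htest h0 =>
    exact absurd h0 (h.bar_ne_zero_of_reachesZeroTest hrw hreg hpot htest)
  | addToBasis p b htest h0 =>
    obtain ⟨u, hu⟩ := h.exists_isSig_toMod htest.1.1
    exact .inl ⟨b, fun hb => h.not_isSig_of_mem hrw htest.1 htest.2.1 hu hb (htest.2.2.isSig hu),
      rfl⟩

end Invariant

lemma not_exists_infinite_run (hrw : IsRewriteOrder τ F rwo) (hreg : IsRegularSequence F)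
    (hpot : τ.IsPot) :
    ¬ ∃ run : ℕ → State n m K, run 0 = initState τ F ∧
      ∀ k, Step τ F rwo (run k) (run (k + 1)) := by
  rintro ⟨run, h0, hstep⟩
  have hinv : ∀ k, Invariant τ F rwo (run k) := by
    intro k
    induction k with
    | zero => exact h0 ▸ invariant_initState
    | succ k ih => exact ih.step hrw hreg hpot (hstep k)
  have hcases := fun k => (hinv k).step_cases hrw hreg hpot (hstep k)
  have hmono : Monotone fun k => (run k).G := by
    refine monotone_nat_of_le_succ fun k => ?_
    rcases hcases k with ⟨b, -, h⟩ | ⟨h, -⟩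
    · rw [h]
      exact Set.subset_insert _ _
    · exact h.ge
  set X := ⋃ k, (run k).G with hX
  have hmem : ∀ k, (run k).G ⊆ X := fun k => Set.subset_iUnion (fun k => (run k).G) k
  have hcommon : ∀ g ∈ X, ∀ g' ∈ X, ∃ k, g ∈ (run k).G ∧ g' ∈ (run k).G := by
    intro g hg g' hg'
    obtain ⟨k, hk⟩ := Set.mem_iUnion.1 hg
    obtain ⟨l, hl⟩ := Set.mem_iUnion.1 hg'
    exact ⟨max k l, hmono (le_max_left k l) hk, hmono (le_max_right k l) hl⟩
  have hfin : X.Finite := by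
    refine finite_of_ratioLT (τ := τ) (F := F) ?_ ?_ ?_ ?_
    · intro g hg
      obtain ⟨k, hk⟩ := Set.mem_iUnion.1 hg
      exact (hinv k).exists_isSig_of_mem hk
    · intro g hg g' hg' w hw hw'
      obtain ⟨k, hk, hk'⟩ := hcommon g hg g' hg'
      exact (hinv k).sig_injective g hk g' hk' w hw hw'
    · intro g hg
      obtain ⟨k, hk⟩ := Set.mem_iUnion.1 hg
      exact ((hinv k).origin g hk).imp_right fun ⟨c, hc, d, hd, h⟩ =>
        ⟨c, hmem k hc, d, hmem k hd, h⟩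
    · intro g hg g' hg' w w' hw hw' hdvd hdeg
      obtain ⟨k, hk, hk'⟩ := hcommon g hg g' hg'
      exact (hinv k).not_ratioLT hrw hk hk' hw hw' hdvd hdeg
  obtain ⟨N, hN⟩ : ∃ N, X ⊆ (run N).G := by
    obtain ⟨N, hN⟩ := hmono.directed_le.exists_mem_subset_of_finset_subset_biUnion
      (s := hfin.toFinset) (by simp [hX])
    exact ⟨N, by simpa using hN⟩
  -- From step `N` on, all steps shrink the finite set of pending elements.
  have hdecr : ∀ k, (run (N + k + 1)).P.ncard < (run (N + k)).P.ncard := by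
    intro k
    rcases hcases (N + k) with ⟨b, hb, h⟩ | ⟨-, h⟩
    · have hbX : b ∈ X := hmem (N + k + 1) (by rw [h]; exact Set.mem_insert _ _)
      exact absurd (hmono (Nat.le_add_right N k) (hN hbX)) hb
    · exact Set.ncard_lt_ncard h (hinv _).finite_P
  obtain ⟨k, hk⟩ := WellFounded.not_rel_apply_succ (r := (· < ·)) fun k => (run (N + k)).P.ncard
  exact hk (hdecr k)

end SigRB

theorem mainTheorem2 {n m : ℕ} {K : Type*} [Field K] (mo : MonomialOrder (Fin n))
    (τ : SigRB.ModuleTermOrder mo m) (F : Fin m → MvPolynomial (Fin n) K)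
    (rwo : SigRB.Term n m × MvPolynomial (Fin n) K → SigRB.Term n m × MvPolynomial (Fin n) K → Prop)
    (hrw : SigRB.IsRewriteOrder τ F rwo) (hreg : SigRB.IsRegularSequence F) (hpot : τ.IsPot) :
    (∀ st, SigRB.Reachable τ F rwo st →
      ∀ p b, SigRB.ReachesZeroTest τ F rwo st p b → SigRB.bar F b ≠ 0) ∧
    SigRB.Terminates τ F rwo ∧
    ∀ G z, SigRB.Returns τ F rwo G z → z = 0 := by
  refine ⟨fun st hst p b => (hst.invariant hrw hreg hpot).bar_ne_zero_of_reachesZeroTest hrw hreg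
    hpot, ⟨SigRB.not_exists_infinite_run hrw hreg hpot, fun st hst =>
      (hst.invariant hrw hreg hpot).exists_step⟩, ?_⟩
  rintro G z ⟨st, hst, -, -, rfl⟩
  exact (hst.invariant hrw hreg hpot).counter
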